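/- **Setting.** For $z,w\in\mathbb C^d$ let $\langle z,w\rangle=\sum_j z_j\overline{w_j}$. Let $\Omega\subseteq\mathbb R^d$ be open. An *elliptic matrix* on $\Omega$ is a measurable $A:\Omega\to\mathbb C^{d\times d}$ such that, for some $\lambda,\Lambda>0$ and a.e. $x\in\Omega$, $\Re\langle A(x)\xi,\xi\rangle\ge\lambda|\xi|^2$ and $|\langle A(x)\xi,\eta\rangle|\le\Lambda|\xi||\eta|$ for all $\xi,\eta\in\mathbb C^d$. For $r>1$, $\mathcal A_r(\Omega)$ is the class of elliptic $A$ such that, for some $C>0$ and a.e. $x$, $\Re\langle A(x)\xi,\xi+|1-2/r|\,\overline\xi\rangle\ge C|\xi|^2$ for all $\xi\in\mathbb C^d$. For a tuple $\mathscr A=(A,b,c,V)$ put $\mathscr A_+=(A,b,c,V_+)$, where $V_+=\max\{V,0\}$, and, with $\mathcal J_r\xi=\xi+(r-2)\Re\xi$, $$\Gamma_r^{\mathscr A}(x,\xi)=\Re\langle A(x)\xi,\mathcal J_r\xi\rangle+\Re\langle\overline{b}(x)+\mathcal J_rc(x),\xi\rangle+V(x).$$ $\mathcal S_r(\Omega)$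 is the class of all $(A,b,c,V)$ with $A\in\mathcal A_r(\Omega)$, $b,c\in L^\infty(\Omega;\mathbb C^d)$ and $0\le V\in L^1_{\rm loc}(\Omega)$ such that, for some $M,\mu>0$ and a.e. $x$, $$|\overline b(x)-c(x)|\le M\sqrt{V(x)},\qquad \Gamma_r^{\mathscr A}(x,\xi)\ge\mu(|\xi|^2+V(x))\quad\text{for all }\xi\in\mathbb C^d.$$ The optimal constants are denoted by $\lambda,\Lambda,M$ and $\mu_r$. For $p\ge2$, $q=p/(p-1)$, $\alpha\ge0$ and $\sigma\in[0,1)$ let $$\mathcal C_{p,\alpha,\sigma}(\mathscr A)=\bigl(A-\alpha\tfrac{pq}{4}I_d,\;b,\;c,\;(1-\sigma)V_+\bigr).$$ For $\Phi:\mathbb C^N\to\mathbb R$, let $D\Phi$ and $D^2\Phi$ be its real gradient and Hessian, under the identification $\mathbb C^N=\mathbb R^{2N}$, viewed as a linear and a bilinear form. For $\omega\in\mathbb C^N$, $\Xi=(\Xi_1,\dots,\Xi_N)\in(\mathbb C^d)^N$, pointwise tuples $\mathscr A_j=(A_j,b_j,c_j,V_j)$, and $\Xi^{(i)}\in\mathbb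 C^N$ the vector of the $i$-th coordinates of $\Xi_1,\dots,\Xi_N$, let $$H_\Phi^{(A_1,\dots,A_N)}[\omega;\Xi]=\sum_{i=1}^dD^2\Phi(\omega)\bigl(\Xi^{(i)},(A_1\Xi_1,\dots,A_N\Xi_N)^{(i)}\bigr),\qquad G_\Phi^{(V_1,\dots,V_N)}(\omega)=D\Phi(\omega)(V_1\omega_1,\dots,V_N\omega_N),$$ $$H_\Phi^{(\mathbf b,\mathbf c)}[\omega;\Xi]=\sum_{i=1}^dD^2\Phi(\omega)\bigl(\Xi^{(i)},(\omega_1c_1,\dots,\omega_Nc_N)^{(i)}\bigr)+D\Phi(\omega)\bigl(\langle\Xi_1,\overline{b_1}\rangle,\dots,\langle\Xi_N,\overline{b_N}\rangle\bigr),$$ and let $\mathbf H_\Phi^{(\mathscr A_1,\dots,\mathscr A_N)}[\omega;\Xi]$ be the sum of these three quantities. Let $F_r(\zeta)=|\zeta|^r$ on $\mathbb C$, $\Upsilon=\{(\zeta,\eta)\in\mathbb C^2:\eta=0\text{ or }|\zeta|^p=|\eta|^q\}$, $\tau(\zeta,\eta)=\max\{|\zeta|^{p-2},|\eta|^{2-q}\}$,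 and, for $\delta>0$, $$\mathcal Q_{p,\delta}(\zeta,\eta)=|\zeta|^p+|\eta|^q+\delta\begin{cases}|\zeta|^2|\eta|^{2-q},&|\zeta|^p\le|\eta|^q,\\ \frac2p|\zeta|^p+\bigl(\frac2q-1\bigr)|\eta|^q,&|\zeta|^p\ge|\eta|^q.\end{cases}$$ For $X,Y\in\mathbb C^d$, writing $X_\zeta=e^{-i\arg\zeta}X$ and $Y_\eta=e^{-i\arg\eta}Y$, let $$h_p[(\zeta,\eta);(X,Y)]=\begin{cases}|\eta|^{2-q}|X|^2+(1-\frac q2)^2|\zeta|^2|\eta|^{-q}|\Re Y_\eta|^2+2(1-\frac q2)|\zeta||\eta|^{1-q}\langle\Re X_\zeta,\Re Y_\eta\rangle,&|\zeta|^p<|\eta|^q,\\[2pt]\frac p2|\zeta|^{p-2}\bigl(\frac p2|\Re X_\zeta|^2+\frac2p|\Im X_\zeta|^2\bigr),&|\zeta|^p\ge|\eta|^q.\end{cases}$$ **Theorem.** Let $p\ge2$, $q=p/(p-1)$, $A,B\in\mathcal A_p(\Omega)$, $b,c,\beta,\gamma\in L^\infty(\Omega;\mathbb C^d)$, and let $V,W\in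 L^1_{\rm loc}(\Omega)$ be real-valued. Put $\mathscr A=(A,b,c,V)$ and $\mathscr B=(B,\beta,\gamma,W)$. Suppose that for some $\alpha_1,\alpha_2\ge0$ and $\sigma_1,\sigma_2\in[0,1)$ $$\mathcal C_{p,\alpha_1,\sigma_1}(\mathscr A)\in\mathcal S_p(\Omega)\cap\mathcal S_2(\Omega),\qquad\mathcal C_{p,\alpha_2,\sigma_2}(\mathscr B)\in\mathcal S_q(\Omega).$$ Then $\tau:\mathbb C^2\to[0,\infty)$ is continuous, $\tau^{-1}$ is locally integrable on $\mathbb C^2\setminus\{(0,0)\}$, and there exist $\delta\in(0,1)$ and $\widetilde C>0$ such that, with $\mathcal Q=\mathcal Q_{p,\delta}$, for a.e. $x\in\Omega$, all $\omega=(\zeta,\eta)\in\mathbb C^2\setminus\Upsilon$ and all $X,Y\in\mathbb C^d$, $$\begin{aligned}\mathbf H_{\mathcal Q}^{(\mathscr A_+(x),\mathscr B_+(x))}[\omega;(X,Y)]\ge{}&\widetilde C\bigl[\tau(\omega)\bigl(|X|^2+V_+(x)|\zeta|^2\bigr)+\tau(\omega)^{-1}\bigl(|Y|^2+W_+(x)|\eta|^2\bigr)\bigr]\\&+\alpha_1\Bigl(\frac{pq}4H_{F_p}^{I_d}[\zeta;X]+2\delta\,h_p[\omega;(X,Y)]\Bigr)\\&+\alpha_2\,[\,q+(2-q)\delta\,]\,\frac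 p4\,H_{F_q}^{I_d}[\eta;Y]+G_{\mathcal Q}^{(\sigma_1V_+(x),\,\sigma_2W_+(x))}(\omega).\end{aligned}$$ The constants $\delta$ and $\widetilde C$ can be chosen so as to depend only on $p,\alpha_1,\alpha_2,\sigma_1,\sigma_2$ and on the ellipticity constants $\lambda,\Lambda,M,\mu_2,\mu_p$ of $\mathcal C_{p,\alpha_1,\sigma_1}(\mathscr A)$ and $\lambda,\Lambda,M,\mu_q$ of $\mathcal C_{p,\alpha_2,\sigma_2}(\mathscr B)$; in particular, not on the dimension $d$. -/

import Mathlib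

open MeasureTheory
open scoped ENNReal ComplexConjugate

noncomputable section

namespace BellmanConvexity

/-- The Euclidean space `ℝ^d`. -/
abbrev RVec (d : ℕ) : Type := EuclideanSpace ℝ (Fin d)

/-- The space `ℂ^d` with its Euclidean norm. -/
abbrev CVec (d : ℕ) : Type := EuclideanSpace ℂ (Fin d)

/-- The sesquilinear product `⟨z, w⟩ = ∑ j, z_j * conj w_j` on `ℂ^d`. -/
def cdot {d : ℕ} (z w : CVec d) : ℂ := ∑ j, z j * conj (w j)

/-- The action `A ξ` of a complex matrix on a complex vector. -/
def mulV {d : ℕ} (A : Matrix (Fin d) (Fin d) ℂ) (ξ : CVec d) : CVec d :=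
  WithLp.toLp 2 (A.mulVec ξ.ofLp)

/-- The coordinatewise complex conjugate of a vector. -/
def conjV {d : ℕ} (ξ : CVec d) : CVec d := WithLp.toLp 2 (fun j => conj (ξ j))

/-- The coordinatewise real part of a vector, as an element of `ℝ^d`. -/
def reV {d : ℕ} (ξ : CVec d) : RVec d := WithLp.toLp 2 (fun j => (ξ j).re)

/-- The coordinatewise imaginary part of a vector, as an element of `ℝ^d`. -/
def imV {d : ℕ} (ξ : CVec d) : RVec d := WithLp.toLp 2 (fun j => (ξ j).im)

/-- The real-linear operator `J_p ξ = ξ + (p - 2) Re ξ` on `ℂ^d`. -/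
def opJ {d : ℕ} (p : ℝ) (ξ : CVec d) : CVec d :=
  WithLp.toLp 2 (fun j => ξ j + (((p - 2) * (ξ j).re : ℝ) : ℂ))

/-- A tuple `(A, b, c, V)`: a complex matrix, two complex vectors, a real scalar. -/
structure Coeffs (d : ℕ) where
  /-- the matrix -/
  A : Matrix (Fin d) (Fin d) ℂ
  /-- the first vector -/
  b : CVec d
  /-- the second vector -/
  c : CVec d
  /-- the potential -/
  V : ℝ

/-- A field of coefficients. Only its values on the open set `Ω` under consideration matter. -/
abbrev CoeffField (d : ℕ) : Type := RVec d → Coeffs d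

/-- The tuple `𝒜_+ = (A, b, c, V_+)`. -/
def plusPart {d : ℕ} (𝒜 : CoeffField d) : CoeffField d := fun x =>
  { A := (𝒜 x).A, b := (𝒜 x).b, c := (𝒜 x).c, V := max (𝒜 x).V 0 }

/-- The perturbed tuple `(A - α (pq/4) I, b, c, (1 - σ) V_+)`, where `q = p / (p - 1)`. -/
def pert {d : ℕ} (p α σ : ℝ) (𝒜 : CoeffField d) : CoeffField d := fun x =>
  { A := (𝒜 x).A - ((α * (p * (p / (p - 1)) / 4) : ℝ) : ℂ) • (1 : Matrix (Fin d) (Fin d) ℂ)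
    b := (𝒜 x).b
    c := (𝒜 x).c
    V := (1 - σ) * max (𝒜 x).V 0 }

/-! ### Classes of coefficients -/

/-- `A` is measurable on `Ω` and satisfies there the two ellipticity inequalities with constants
`lam` and `Lam`. -/
def EllipticWith {d : ℕ} (Ω : Set (RVec d)) (A : RVec d → Matrix (Fin d) (Fin d) ℂ)
    (lam Lam : ℝ) : Prop :=
  (∀ i j, AEMeasurable (fun x => A x i j) (volume.restrict Ω)) ∧
  ∀ᵐ x ∂(volume.restrict Ω),
    (∀ ξ : CVec d, lam * ‖ξ‖ ^ 2 ≤ (cdot (mulV (A x) ξ) ξ).re) ∧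
    (∀ ξ η : CVec d, ‖cdot (mulV (A x) ξ) η‖ ≤ Lam * ‖ξ‖ * ‖η‖)

/-- The class of elliptic matrix functions on `Ω`. -/
def Elliptic {d : ℕ} (Ω : Set (RVec d)) (A : RVec d → Matrix (Fin d) (Fin d) ℂ) : Prop :=
  ∃ lam Lam : ℝ, 0 < lam ∧ 0 < Lam ∧ EllipticWith Ω A lam Lam

/-- The class of `p`-elliptic matrix functions on `Ω`. -/
def PElliptic {d : ℕ} (Ω : Set (RVec d)) (p : ℝ)
    (A : RVec d → Matrix (Fin d) (Fin d) ℂ) : Prop :=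
  Elliptic Ω A ∧ ∃ C : ℝ, 0 < C ∧ ∀ᵐ x ∂(volume.restrict Ω), ∀ ξ : CVec d,
    C * ‖ξ‖ ^ 2 ≤ (cdot (mulV (A x) ξ) (ξ + ((|1 - 2 / p| : ℝ) : ℂ) • conjV ξ)).re

/-- The function `Γ_p(ξ) = Re ⟨A ξ, J_p ξ⟩ + Re ⟨conj b + J_p c, ξ⟩ + V`
of a tuple `(A, b, c, V)`. -/
def Gam {d : ℕ} (p : ℝ) (a : Coeffs d) (ξ : CVec d) : ℝ :=
  (cdot (mulV a.A ξ) (opJ p ξ)).re + (cdot (conjV a.b + opJ p a.c) ξ).re + a.V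

/-- `|conj b - c| ≤ M √V` almost everywhere on `Ω`. -/
def FirstOrderBound {d : ℕ} (Ω : Set (RVec d)) (𝒜 : CoeffField d) (M : ℝ) : Prop :=
  ∀ᵐ x ∂(volume.restrict Ω), ‖conjV (𝒜 x).b - (𝒜 x).c‖ ≤ M * Real.sqrt (𝒜 x).V

/-- `Γ_p(x, ξ) ≥ μ (|ξ|² + V(x))` for almost every `x ∈ Ω` and all `ξ`. -/
def GamBound {d : ℕ} (Ω : Set (RVec d)) (p : ℝ) (𝒜 : CoeffField d) (μ : ℝ) : Prop :=
  ∀ᵐ x ∂(volume.restrict Ω), ∀ ξ : CVec d, μ * (‖ξ‖ ^ 2 + (𝒜 x).V) ≤ Gam p (𝒜 x) ξ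

/-- The class `𝒲_p(Ω)`. -/
structure ClassW {d : ℕ} (Ω : Set (RVec d)) (p : ℝ) (𝒜 : CoeffField d) : Prop where
  pElliptic : PElliptic Ω p (fun x => (𝒜 x).A)
  memLp_b : MemLp (fun x => (𝒜 x).b) ∞ (volume.restrict Ω)
  memLp_c : MemLp (fun x => (𝒜 x).c) ∞ (volume.restrict Ω)
  locInt_V : LocallyIntegrableOn (fun x => (𝒜 x).V) Ω volume
  nonneg_V : ∀ᵐ x ∂(volume.restrict Ω), 0 ≤ (𝒜 x).V
  gam_nonneg : ∀ᵐ x ∂(volume.restrict Ω), ∀ ξ : CVec d, 0 ≤ Gam p (𝒜 x) ξ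
  firstOrder : ∃ M : ℝ, 0 < M ∧ FirstOrderBound Ω 𝒜 M

/-- The class `𝒮_p(Ω)`. -/
def ClassS {d : ℕ} (Ω : Set (RVec d)) (p : ℝ) (𝒜 : CoeffField d) : Prop :=
  ClassW Ω p 𝒜 ∧ ∃ μ : ℝ, 0 < μ ∧ GamBound Ω p 𝒜 μ

/-! ### Generalized Hessians

For `Φ : ℂ^N → ℝ`, twice differentiable in the real sense at `ω`, the real Hessian matrix
of `Φ` at `ω` (a `2N × 2N` matrix) is the matrix of the bilinear form
`(u, v) ↦ fderiv ℝ (fderiv ℝ Φ) ω u v` on `ℂ^N = ℝ^{2N}`. Tensoring with the identity of `ℝ^d`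
and pairing two elements of `(ℂ^d)^N = ℝ^{2Nd}` amounts to summing this form over the `d`
coordinates. Moreover the real form of a matrix `A` acts on `ℝ^{2d} = ℂ^d` as `A` does. -/

/-- `⟨[D²Φ(ω) ⊗ I] Ξ, Ξ'⟩` for `Ξ, Ξ' ∈ (ℂ^d)^N`. -/
def hessPair {N d : ℕ} (Φ : (Fin N → ℂ) → ℝ) (ω : Fin N → ℂ) (Ξ Ξ' : Fin N → CVec d) : ℝ :=
  ∑ i : Fin d, fderiv ℝ (fderiv ℝ Φ) ω (fun j => Ξ j i) (fun j => Ξ' j i)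

/-- The generalized Hessian `H_Φ^{(A_1, …, A_N)}[ω; Ξ]` with respect to matrices. -/
def hessA {N d : ℕ} (Φ : (Fin N → ℂ) → ℝ) (A : Fin N → Matrix (Fin d) (Fin d) ℂ)
    (ω : Fin N → ℂ) (Ξ : Fin N → CVec d) : ℝ :=
  hessPair Φ ω Ξ (fun j => mulV (A j) (Ξ j))

/-- The first-order part `H_Φ^{(b, c)}[ω; Ξ]`. -/
def hessBC {N d : ℕ} (Φ : (Fin N → ℂ) → ℝ) (b c : Fin N → CVec d)
    (ω : Fin N → ℂ) (Ξ : Fin N → CVec d) : ℝ :=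
  hessPair Φ ω Ξ (fun j => ω j • c j) +
    fderiv ℝ Φ ω (fun j => cdot (Ξ j) (conjV (b j)))

/-- The potential part `G_Φ^V(ω)`. -/
def gradV {N : ℕ} (Φ : (Fin N → ℂ) → ℝ) (V : Fin N → ℝ) (ω : Fin N → ℂ) : ℝ :=
  fderiv ℝ Φ ω (fun j => (V j : ℂ) * ω j)

/-- The full generalized Hessian `𝐇_Φ^{(𝒜_1, …, 𝒜_N)}[ω; Ξ]`. -/
def hessFull {N d : ℕ} (Φ : (Fin N → ℂ) → ℝ) (a : Fin N → Coeffs d)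
    (ω : Fin N → ℂ) (Ξ : Fin N → CVec d) : ℝ :=
  hessA Φ (fun j => (a j).A) ω Ξ + hessBC Φ (fun j => (a j).b) (fun j => (a j).c) ω Ξ +
    gradV Φ (fun j => (a j).V) ω

/-! ### The Bellman function and the auxiliary functions -/

/-- The power function `F_r(ζ) = |ζ|^r` on `ℂ`, as a function of one complex variable `ω 0`. -/
def powF (r : ℝ) (ω : Fin 1 → ℂ) : ℝ := ‖ω 0‖ ^ r

/-- `H_{F_r}^{I}[ζ; X]`. -/
def hessPow {d : ℕ} (r : ℝ) (ζ : ℂ) (X : CVec d) : ℝ :=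
  hessA (powF r) ![(1 : Matrix (Fin d) (Fin d) ℂ)] ![ζ] ![X]

/-- The Bellman function `𝒬_{p, δ}(ζ, η)`, with `ζ = ω 0`, `η = ω 1` and `q = p / (p - 1)`. -/
def bellmanQ (p δ : ℝ) (ω : Fin 2 → ℂ) : ℝ :=
  let q := p / (p - 1)
  ‖ω 0‖ ^ p + ‖ω 1‖ ^ q +
    δ * (if ‖ω 0‖ ^ p ≤ ‖ω 1‖ ^ q then ‖ω 0‖ ^ (2 : ℝ) * ‖ω 1‖ ^ (2 - q)
      else (2 / p) * ‖ω 0‖ ^ p + (2 / q - 1) * ‖ω 1‖ ^ q)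

/-- The exceptional set `Υ = {η = 0} ∪ {|ζ|^p = |η|^q}`, with `q = p / (p - 1)`. -/
def excSet (p : ℝ) : Set (ℂ × ℂ) :=
  {ω | ω.2 = 0 ∨ ‖ω.1‖ ^ p = ‖ω.2‖ ^ (p / (p - 1))}

/-- The weight `τ(ζ, η) = max {|ζ|^{p-2}, |η|^{2-q}}`, with `q = p / (p - 1)`. -/
def tau (p : ℝ) (ω : ℂ × ℂ) : ℝ :=
  max (‖ω.1‖ ^ (p - 2)) (‖ω.2‖ ^ (2 - p / (p - 1)))

/-- The rotated vector `e^{-i arg ζ} X`. -/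
def rot {d : ℕ} (ζ : ℂ) (X : CVec d) : CVec d :=
  Complex.exp (-(Complex.arg ζ : ℂ) * Complex.I) • X

/-- The function `b_p[(ζ, η); (X, Y)]`, to be used for `η ≠ 0` only. -/
def bFun {d : ℕ} (p : ℝ) (ζ η : ℂ) (X Y : CVec d) : ℝ :=
  let q := p / (p - 1)
  ‖η‖ ^ (2 - q) * ‖X‖ ^ 2 +
    (1 - q / 2) ^ 2 * ‖ζ‖ ^ 2 * ‖η‖ ^ (-q) * ‖reV (rot η Y)‖ ^ 2 +
    2 * (1 - q / 2) * ‖ζ‖ * ‖η‖ ^ (1 - q) * inner ℝ (reV (rot ζ X)) (reV (rot η Y))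

/-- The function `g_p[ζ; X]`. -/
def gFun {d : ℕ} (p : ℝ) (ζ : ℂ) (X : CVec d) : ℝ :=
  p / 2 * ‖ζ‖ ^ (p - 2) *
    (p / 2 * ‖reV (rot ζ X)‖ ^ 2 + 2 / p * ‖imV (rot ζ X)‖ ^ 2)

/-- The function `h_p[(ζ, η); (X, Y)]`. -/
def hFun {d : ℕ} (p : ℝ) (ζ η : ℂ) (X Y : CVec d) : ℝ :=
  if ‖ζ‖ ^ p < ‖η‖ ^ (p / (p - 1)) then bFun p ζ η X Y else gFun p ζ X

end BellmanConvexity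

end

open BellmanConvexity

/-!
The inequality is pointwise in `x`, and it is linear in the coefficients: subtracting the scalar
matrices `α pq/4` and the parts `σ V_+` of the potentials reduces it to the perturbed tuples plus
an explicit contribution of scalar matrices (`hessFull_eq_perturbed`). For a single power the
generalized Hessian is
`r |z|^{r-2} (Re ⟨Aξ, J_r ξ⟩ + |z| Re ⟨conj b + J_r c, ξ⟩ + V |z|²)` with `ξ = e^{-i arg z} X`
(`powBil_add_powLin`), that is `r |z|^r Γ_r(ξ / |z|)`, so the hypotheses on `Γ_p`, `Γ_q` bound it
below by a multiple of `|z|^{r-2} (|X|² + V |z|²)` (`le_quad`).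

Where `|ζ|^p > |η|^q`, the function `𝒬` is a combination of the two powers with coefficients at
least `1`, and nothing more is needed (`lower_bound_of_gt`).

Where `|ζ|^p < |η|^q`, the extra summand is `δ |ζ|² |η|^{2-q}`. The power `|ζ|^p` contributes
nonnegatively, `|η|^q` yields `τ⁻¹ (|Y|² + W |η|²)`, and the pure `ζ` part of the extra summand
yields `δ τ (|X|² + V |ζ|²)` through `Γ_2`. All other terms carry the factor `δ` and are products
containing `τ^{-1/2} |Y|` or `τ^{-1/2} |η| √W`, because `|ζ| |η|^{1-q} ≤ 1` in this region
(`mixed_terms_lower_bound`, `scalar_perturbation_lower_bound`). A small `δ` absorbs them (`absorb`).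
This uses that `|b|` and `|c|` are bounded by constant multiples of `√V`, with constants that do
not involve the sup norms of the first-order coefficients: `Γ_r ≥ 0` bounds `|conj b + J_r c|`, and
`|conj b - c|` is bounded by hypothesis (`norm_coeff_le`).
-/

namespace BellmanConvexity

open Filter Topology

/-! ### Calculus of second differentials -/

/-- `HasHess Φ x g H`: near `x` the function `Φ` is differentiable, its differential is
differentiable at `x`, and `g`, `H` are the values of the first and second differentials at `x`.
The values are recorded as plain functions, so that explicit formulas can be substituted. -/
structure HasHess {E : Type*} [NormedAddCommGroup E] [NormedSpace ℝ E]
    (Φ : E → ℝ) (x : E) (g : E → ℝ) (H : E → E → ℝ) : Prop where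
  eventually_differentiableAt : ∀ᶠ y in 𝓝 x, DifferentiableAt ℝ Φ y
  differentiableAt_fderiv : DifferentiableAt ℝ (fderiv ℝ Φ) x
  fderiv_apply : ∀ v, fderiv ℝ Φ x v = g v
  fderiv_fderiv_apply : ∀ u v, fderiv ℝ (fderiv ℝ Φ) x u v = H u v

namespace HasHess

variable {E F : Type*} [NormedAddCommGroup E] [NormedSpace ℝ E]
  [NormedAddCommGroup F] [NormedSpace ℝ F] {Φ Ψ : E → ℝ} {x : E} {g g' : E → ℝ} {H H' : E → E → ℝ}

theorem of_eventually {L : E → E →L[ℝ] ℝ} {M : E →L[ℝ] E →L[ℝ] ℝ}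
    (h : ∀ᶠ y in 𝓝 x, HasFDerivAt Φ (L y) y) (hL : HasFDerivAt L M x)
    (hg : ∀ v, L x v = g v) (hH : ∀ u v, M u v = H u v) : HasHess Φ x g H := by
  have e : fderiv ℝ Φ =ᶠ[𝓝 x] L := h.mono fun y hy => hy.fderiv
  have hM := hL.congr_of_eventuallyEq e
  refine ⟨h.mono fun y hy => hy.differentiableAt, hM.differentiableAt, fun v => ?_, fun u v => ?_⟩
  · rw [h.self_of_nhds.fderiv, hg]
  · rw [hM.fderiv, hH]

theorem congr (h : HasHess Φ x g H) (e : Ψ =ᶠ[𝓝 x] Φ) : HasHess Ψ x g H := by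
  refine of_eventually (L := fderiv ℝ Φ) ?_ h.differentiableAt_fderiv.hasFDerivAt
    h.fderiv_apply h.fderiv_fderiv_apply
  filter_upwards [h.eventually_differentiableAt, e.eventually_nhds] with y hy hey
  exact hy.hasFDerivAt.congr_of_eventuallyEq hey

theorem add (h : HasHess Φ x g H) (h' : HasHess Ψ x g' H') :
    HasHess (fun y => Φ y + Ψ y) x (fun v => g v + g' v) (fun u v => H u v + H' u v) := by
  refine of_eventually (L := fun y => fderiv ℝ Φ y + fderiv ℝ Ψ y) ?_
    (h.differentiableAt_fderiv.hasFDerivAt.add h'.differentiableAt_fderiv.hasFDerivAt) ?_ ?_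
  · filter_upwards [h.eventually_differentiableAt, h'.eventually_differentiableAt] with y hy hy'
    exact hy.hasFDerivAt.add hy'.hasFDerivAt
  · intro v; simp [h.fderiv_apply, h'.fderiv_apply]
  · intro u v; simp [h.fderiv_fderiv_apply, h'.fderiv_fderiv_apply]

theorem mul (h : HasHess Φ x g H) (h' : HasHess Ψ x g' H') :
    HasHess (fun y => Φ y * Ψ y) x (fun v => Φ x * g' v + Ψ x * g v)
      (fun u v => Φ x * H' u v + Ψ x * H u v + g u * g' v + g' u * g v) := by
  refine of_eventually (L := fun y => Φ y • fderiv ℝ Ψ y + Ψ y • fderiv ℝ Φ y) ?_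
    ((h.eventually_differentiableAt.self_of_nhds.hasFDerivAt.smul
      h'.differentiableAt_fderiv.hasFDerivAt).add
      (h'.eventually_differentiableAt.self_of_nhds.hasFDerivAt.smul
      h.differentiableAt_fderiv.hasFDerivAt)) ?_ ?_
  · filter_upwards [h.eventually_differentiableAt, h'.eventually_differentiableAt] with y hy hy'
    exact hy.hasFDerivAt.mul hy'.hasFDerivAt
  · intro v; simp [h.fderiv_apply, h'.fderiv_apply]
  · intro u v
    simp [h.fderiv_fderiv_apply, h'.fderiv_fderiv_apply, h.fderiv_apply, h'.fderiv_apply]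
    ring

theorem const_mul (k : ℝ) (h : HasHess Φ x g H) :
    HasHess (fun y => k * Φ y) x (fun v => k * g v) (fun u v => k * H u v) := by
  refine of_eventually (L := fun y => k • fderiv ℝ Φ y) ?_
    (h.differentiableAt_fderiv.hasFDerivAt.const_smul k) ?_ ?_
  · filter_upwards [h.eventually_differentiableAt] with y hy
    exact hy.hasFDerivAt.const_mul k
  · intro v; simp [h.fderiv_apply]
  · intro u v; simp [h.fderiv_fderiv_apply]

theorem comp_clm (ℓ : F →L[ℝ] E) {y : F} (h : HasHess Φ (ℓ y) g H) :
    HasHess (fun z => Φ (ℓ z)) y (fun v => g (ℓ v)) (fun u v => H (ℓ u) (ℓ v)) := by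
  have hcont : Tendsto ℓ (𝓝 y) (𝓝 (ℓ y)) := ℓ.continuous.continuousAt
  refine of_eventually (L := fun z => (fderiv ℝ Φ (ℓ z)).comp ℓ)
    (M := ((ContinuousLinearMap.compL ℝ F E ℝ).flip ℓ).comp
      ((fderiv ℝ (fderiv ℝ Φ) (ℓ y)).comp ℓ)) ?_ ?_ ?_ ?_
  · filter_upwards [hcont.eventually h.eventually_differentiableAt] with z hz
    exact hz.hasFDerivAt.comp z ℓ.hasFDerivAt
  · exact (((ContinuousLinearMap.compL ℝ F E ℝ).flip ℓ).hasFDerivAt).comp y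
      (h.differentiableAt_fderiv.hasFDerivAt.comp y ℓ.hasFDerivAt)
  · intro v; simp [h.fderiv_apply]
  · intro u v; simp [h.fderiv_fderiv_apply]

end HasHess

/-! ### Powers of the modulus -/

/-- The unimodular factor `e^{-i arg z}` that rotates `z` to the positive half-axis. -/
noncomputable def phase (z : ℂ) : ℂ := Complex.exp (-(Complex.arg z : ℂ) * Complex.I)

theorem norm_phase (z : ℂ) : ‖phase z‖ = 1 := by
  have : (-(Complex.arg z : ℂ) * Complex.I) = ((-Complex.arg z : ℝ) : ℂ) * Complex.I := by
    push_cast; ring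
  rw [phase, this, Complex.norm_exp_ofReal_mul_I]

theorem phase_mul_self (z : ℂ) : phase z * z = ‖z‖ := by
  have h := Complex.norm_mul_exp_arg_mul_I z
  calc phase z * z = phase z * (‖z‖ * Complex.exp (Complex.arg z * Complex.I)) := by rw [h]
    _ = ‖z‖ * Complex.exp (-(Complex.arg z : ℂ) * Complex.I + Complex.arg z * Complex.I) := by
      rw [phase, Complex.exp_add]; ring
    _ = ‖z‖ := by simp

theorem phase_mul_conj (z : ℂ) : phase z * conj (phase z) = 1 := by
  rw [Complex.mul_conj, Complex.normSq_eq_norm_sq, norm_phase]; simp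

theorem inner_eq_norm_mul_phase (z v : ℂ) : inner ℝ z v = ‖z‖ * (phase z * v).re := by
  have h : phase z * v * conj (phase z * z) = v * conj z := by
    rw [map_mul]
    linear_combination (v * conj z) * phase_mul_conj z
  rw [phase_mul_self, Complex.conj_ofReal] at h
  rw [Complex.inner, ← h, Complex.re_mul_ofReal, mul_comm]

/-- The real inner product of `ℂ = ℝ²` as a bounded real-bilinear map. -/
noncomputable def realInner : ℂ →L[ℝ] ℂ →L[ℝ] ℝ :=
  LinearMap.mkContinuous₂ (innerₗ ℂ) 1 fun u v => by
    simpa using norm_inner_le_norm (𝕜 := ℝ) u v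

theorem realInner_apply (u v : ℂ) : realInner u v = inner ℝ u v := rfl

theorem hasFDerivAt_norm_rpow_of_ne {z : ℂ} (hz : z ≠ 0) (r : ℝ) :
    HasFDerivAt (fun y : ℂ => ‖y‖ ^ r) ((r * ‖z‖ ^ (r - 2)) • realInner z) z := by
  have hpos : 0 < ‖z‖ := norm_pos_iff.2 hz
  have h1 : HasFDerivAt (fun y : ℂ => ‖y‖ ^ 2) (2 • innerSL ℝ z) z :=
    (hasStrictFDerivAt_norm_sq z).hasFDerivAt
  have h2 := h1.rpow_const (p := r / 2) (Or.inl (by positivity))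
  have e : (fun y : ℂ => (‖y‖ ^ 2) ^ (r / 2)) = fun y => ‖y‖ ^ r := by
    funext y
    rw [← Real.rpow_natCast, ← Real.rpow_mul (norm_nonneg _)]
    congr 1; push_cast; ring
  rw [e] at h2
  refine h2.congr_fderiv (ContinuousLinearMap.ext fun v => ?_)
  have : (‖z‖ ^ 2) ^ (r / 2 - 1) = ‖z‖ ^ (r - 2) := by
    rw [← Real.rpow_natCast, ← Real.rpow_mul (norm_nonneg _)]
    congr 1; push_cast; ring
  simp only [this, smul_apply, realInner_apply, innerSL_apply_apply, smul_eq_mul, nsmul_eq_mul]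
  push_cast; ring

/-- The differential of `y ↦ r |y|^{r-2} ⟨y, ·⟩`, which is the gradient of `|y|^r`. At the origin
the exponent condition `2 ≤ r` is needed, and the formula relies on `0 ^ 0 = 1`. -/
theorem hasFDerivAt_norm_rpow_smul_inner {z : ℂ} {r : ℝ} (h : z ≠ 0 ∨ 2 ≤ r) :
    HasFDerivAt (fun y : ℂ => (r * ‖y‖ ^ (r - 2)) • realInner y)
      ((r * ‖z‖ ^ (r - 2)) • realInner +
        ((r * ((r - 2) * ‖z‖ ^ (r - 2 - 2))) • realInner z).smulRight (realInner z)) z := by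
  by_cases hz : z = 0
  · have hr : 2 ≤ r := by tauto
    subst hz
    rcases hr.eq_or_lt with rfl | hr
    · have h1 := (realInner.hasFDerivAt (x := 0)).const_smul (2 : ℝ)
      refine (h1.congr_fderiv (ContinuousLinearMap.ext fun u => ?_)).congr_of_eventuallyEq
        (Eventually.of_forall fun y => ?_)
      · simp
      · simp
    · have h0 : (0 : ℝ) ^ (r - 2) = 0 := Real.zero_rpow (by linarith)
      simp only [norm_zero, h0, mul_zero, map_zero, smul_zero,
        ContinuousLinearMap.smulRight_zero]
      rw [hasFDerivAt_iff_isLittleO]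
      simp only [map_zero, smul_zero, sub_zero]
      have hc : Tendsto (fun y : ℂ => r * ‖y‖ ^ (r - 2)) (𝓝 0) (𝓝 0) := by
        have : ContinuousAt (fun y : ℂ => r * ‖y‖ ^ (r - 2)) 0 :=
          (continuous_const.mul
            (continuous_norm.rpow_const fun _ => Or.inr (by linarith))).continuousAt
        simpa [ContinuousAt, h0] using this
      have h1 : (fun y : ℂ => r * ‖y‖ ^ (r - 2)) =o[𝓝 0] (fun _ => (1 : ℝ)) :=
        (Asymptotics.isLittleO_one_iff ℝ).2 hc
      have h2 : (fun y : ℂ => realInner y) =O[𝓝 0] (fun y => y) :=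
        realInner.isBigO_id _
      have h3 := h1.smul_isBigO h2
      simpa using h3
  · have h1 := (hasFDerivAt_norm_rpow_of_ne hz (r - 2)).const_mul r
    have h2 := h1.smul (realInner.hasFDerivAt (x := z))
    refine h2.congr_fderiv ?_
    rw [smul_smul]

/-- First and second differentials of `|z|^r` in the rotated frame of `z`. -/
theorem hasHess_norm_rpow {z : ℂ} {r : ℝ} (h : z ≠ 0 ∨ 2 ≤ r) :
    HasHess (fun y : ℂ => ‖y‖ ^ r) z
      (fun v => r * ‖z‖ ^ (r - 2) * (‖z‖ * (phase z * v).re))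
      (fun u v => r * ‖z‖ ^ (r - 2) *
        ((u * conj v).re + (r - 2) * ((phase z * u).re * (phase z * v).re))) := by
  refine HasHess.of_eventually ?_ (hasFDerivAt_norm_rpow_smul_inner h) ?_ ?_
  · rcases h with hz | hr
    · filter_upwards [isOpen_ne.mem_nhds hz] with y hy using hasFDerivAt_norm_rpow_of_ne hy r
    · exact Eventually.of_forall fun y => 
        hasFDerivAt_norm_rpow y (by linarith)
  · intro v; simp only [smul_apply, realInner_apply, smul_eq_mul, inner_eq_norm_mul_phase]
  · intro u v
    have e : (inner ℝ u v : ℝ) = (u * conj v).re := by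
      rw [Complex.inner]; simp; ring
    have e2 : (r - 2) * ‖z‖ ^ (r - 2 - 2) * (‖z‖ * ‖z‖) = (r - 2) * ‖z‖ ^ (r - 2) := by
      by_cases hz : z = 0
      · have hr : 2 ≤ r := by tauto
        subst hz
        rcases hr.eq_or_lt with rfl | hr
        · simp
        · simp [Real.zero_rpow (show r - 2 ≠ 0 by linarith)]
      · have hpos : 0 < ‖z‖ := norm_pos_iff.2 hz
        rw [mul_assoc, ← sq, ← Real.rpow_natCast, ← Real.rpow_add hpos]
        congr 2; push_cast; ring
    simp only [add_apply, smul_apply,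
      ContinuousLinearMap.smulRight_apply, realInner_apply, smul_eq_mul,
      inner_eq_norm_mul_phase z]
    rw [e]
    linear_combination r * (phase z * u).re * (phase z * v).re * e2

/-! ### Linear algebra in the rotated frame -/

section Vector

variable {d : ℕ}

theorem rot_apply (z : ℂ) (X : CVec d) (i : Fin d) : rot z X i = phase z * X i := rfl

theorem re_cdot (X Y : CVec d) : (cdot X Y).re = ∑ i, (X i * conj (Y i)).re := by
  simp [cdot, Complex.re_sum]

theorem inner_reV (X Y : CVec d) : inner ℝ (reV X) (reV Y) = ∑ i, (X i).re * (Y i).re := by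
  simp [reV, PiLp.inner_apply, mul_comm]

theorem inner_reV_rot (z w : ℂ) (X Y : CVec d) :
    inner ℝ (reV (rot z X)) (reV (rot w Y)) =
      ∑ i, (phase z * X i).re * (phase w * Y i).re := by
  simp only [inner_reV, rot_apply]

theorem cdot_eq_inner (X Y : CVec d) : cdot X Y = inner ℂ Y X := by
  simp [cdot, PiLp.inner_apply]

theorem cdot_rot (z : ℂ) (X Y : CVec d) : cdot (rot z X) (rot z Y) = cdot X Y := by
  unfold cdot
  refine Finset.sum_congr rfl fun i _ => ?_
  rw [rot_apply, rot_apply, map_mul]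
  linear_combination (X i * conj (Y i)) * phase_mul_conj z

theorem norm_rot (z : ℂ) (X : CVec d) : ‖rot z X‖ = ‖X‖ := by
  change ‖phase z • X‖ = _
  rw [norm_smul, norm_phase, one_mul]

theorem rot_mulV (z : ℂ) (A : Matrix (Fin d) (Fin d) ℂ) (X : CVec d) :
    rot z (mulV A X) = mulV A (rot z X) := by
  change phase z • mulV A X = mulV A (phase z • X)
  simp [mulV, Matrix.mulVec_smul]

theorem rot_smul_self (z : ℂ) (c : CVec d) : rot z (z • c) = (‖z‖ : ℂ) • c := by
  change phase z • z • c = _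
  rw [smul_smul, phase_mul_self]

theorem mulV_smul (A : Matrix (Fin d) (Fin d) ℂ) (k : ℂ) (X : CVec d) :
    mulV A (k • X) = k • mulV A X := by
  simp [mulV, Matrix.mulVec_smul]

theorem cdot_comm_re (X Y : CVec d) : (cdot X Y).re = (cdot Y X).re := by
  rw [re_cdot, re_cdot]
  refine Finset.sum_congr rfl fun i _ => ?_
  simp; ring

theorem re_cdot_opJ_right (r : ℝ) (X Y : CVec d) :
    (cdot X (opJ r Y)).re = (cdot X Y).re + (r - 2) * inner ℝ (reV X) (reV Y) := by
  rw [re_cdot, re_cdot, inner_reV, Finset.mul_sum, ← Finset.sum_add_distrib]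
  refine Finset.sum_congr rfl fun i _ => ?_
  simp [opJ]; ring

theorem re_cdot_opJ_left (r : ℝ) (X Y : CVec d) :
    (cdot (opJ r X) Y).re = (cdot X Y).re + (r - 2) * inner ℝ (reV X) (reV Y) := by
  rw [cdot_comm_re, re_cdot_opJ_right, cdot_comm_re, real_inner_comm]

theorem cdot_add_left (X Y Z : CVec d) : cdot (X + Y) Z = cdot X Z + cdot Y Z := by
  simp [cdot, add_mul, Finset.sum_add_distrib]

theorem re_cdot_real_smul_right (s : ℝ) (X Y : CVec d) :
    (cdot X ((s : ℂ) • Y)).re = s * (cdot X Y).re := by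
  rw [re_cdot, re_cdot, Finset.mul_sum]
  refine Finset.sum_congr rfl fun i _ => ?_
  simp; ring

theorem re_cdot_real_smul_left (s : ℝ) (X Y : CVec d) :
    (cdot ((s : ℂ) • X) Y).re = s * (cdot X Y).re := by
  rw [cdot_comm_re, re_cdot_real_smul_right, cdot_comm_re]

theorem reV_real_smul (s : ℝ) (X : CVec d) : reV ((s : ℂ) • X) = s • reV X := by
  ext i; simp [reV]

theorem opJ_real_smul (r s : ℝ) (X : CVec d) : opJ r ((s : ℂ) • X) = (s : ℂ) • opJ r X := by
  ext i; simp [opJ]; ring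

theorem phase_mul_cdot (z : ℂ) (X Y : CVec d) : phase z * cdot X Y = cdot (rot z X) Y := by
  simp only [cdot, Finset.mul_sum, rot_apply, mul_assoc]

theorem norm_cdot_le (X Y : CVec d) : ‖cdot X Y‖ ≤ ‖X‖ * ‖Y‖ := by
  rw [cdot_eq_inner, mul_comm]; exact norm_inner_le_norm _ _

theorem abs_re_cdot_le (X Y : CVec d) : |(cdot X Y).re| ≤ ‖X‖ * ‖Y‖ :=
  (Complex.abs_re_le_norm _).trans (norm_cdot_le X Y)

theorem norm_sq_eq_reV_add_imV (X : CVec d) : ‖X‖ ^ 2 = ‖reV X‖ ^ 2 + ‖imV X‖ ^ 2 := by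
  simp only [EuclideanSpace.norm_sq_eq, reV, imV, ← Finset.sum_add_distrib]
  refine Finset.sum_congr rfl fun i _ => ?_
  rw [← Complex.normSq_eq_norm_sq, Complex.normSq_apply]
  simp; ring

theorem norm_reV_le (X : CVec d) : ‖reV X‖ ≤ ‖X‖ := by
  have := norm_sq_eq_reV_add_imV X
  exact le_of_sq_le_sq (by nlinarith [sq_nonneg ‖imV X‖]) (norm_nonneg _)

theorem abs_inner_reV_le (X Y : CVec d) : |inner ℝ (reV X) (reV Y)| ≤ ‖X‖ * ‖Y‖ :=
  (abs_real_inner_le_norm _ _).trans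
    (mul_le_mul (norm_reV_le X) (norm_reV_le Y) (norm_nonneg _) (norm_nonneg _))

theorem re_cdot_self (X : CVec d) : (cdot X X).re = ‖X‖ ^ 2 := by
  rw [cdot_eq_inner, inner_self_eq_norm_sq_to_K]
  norm_cast

theorem norm_conjV (X : CVec d) : ‖conjV X‖ = ‖X‖ := by
  simp [EuclideanSpace.norm_eq, conjV]

end Vector

/-! ### The quadratic form of a coefficient tuple -/

section Quad

variable {d : ℕ}

/-- The homogenization of `Γ_r`: for `s > 0` it equals `s² Γ_r(ξ / s)`. -/
noncomputable def quad (r : ℝ) (a : Coeffs d) (s : ℝ) (ξ : CVec d) : ℝ :=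
  (cdot (mulV a.A ξ) (opJ r ξ)).re + s * (cdot (conjV a.b + opJ r a.c) ξ).re + a.V * s ^ 2

theorem quad_eq_sq_mul_gam (r : ℝ) (a : Coeffs d) {s : ℝ} (hs : 0 < s) (ξ : CVec d) :
    quad r a s ξ = s ^ 2 * Gam r a (((s⁻¹ : ℝ) : ℂ) • ξ) := by
  rw [quad, Gam, mulV_smul, opJ_real_smul, re_cdot_real_smul_left, re_cdot_real_smul_right,
    re_cdot_real_smul_right]
  field_simp

/-- The lower bound of `Γ_r` homogenizes. At `s = 0`, where no rescaling is available, it follows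
by letting `s` tend to `0`. -/
theorem le_quad {r μ : ℝ} {a : Coeffs d}
    (h : ∀ ξ : CVec d, μ * (‖ξ‖ ^ 2 + a.V) ≤ Gam r a ξ) {s : ℝ} (hs : 0 ≤ s) (ξ : CVec d) :
    μ * (‖ξ‖ ^ 2 + a.V * s ^ 2) ≤ quad r a s ξ := by
  have hclosed : IsClosed {s : ℝ | μ * (‖ξ‖ ^ 2 + a.V * s ^ 2) ≤ quad r a s ξ} := by
    refine isClosed_le (by fun_prop) ?_
    unfold quad; fun_prop
  have hsub : Set.Ioi (0 : ℝ) ⊆ {s : ℝ | μ * (‖ξ‖ ^ 2 + a.V * s ^ 2) ≤ quad r a s ξ} := by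
    intro s (hs : 0 < s)
    have := mul_le_mul_of_nonneg_left (h (((s⁻¹ : ℝ) : ℂ) • ξ)) (sq_nonneg s)
    rw [← quad_eq_sq_mul_gam r a hs, norm_smul, Complex.norm_real,
      Real.norm_of_nonneg (by positivity)] at this
    refine le_trans (le_of_eq ?_) this
    field_simp
  have := closure_minimal hsub hclosed
  rw [closure_Ioi] at this
  exact this hs

end Quad

/-! ### Evaluation of the generalized Hessians -/

section Evaluation

variable {d : ℕ}

/-- The second differential of `|z|^r`, tensored with the identity of `ℝ^d`. -/
noncomputable def powBil (r : ℝ) (z : ℂ) (X Y : CVec d) : ℝ :=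
  r * ‖z‖ ^ (r - 2) *
    ((cdot X Y).re + (r - 2) * inner ℝ (reV (rot z X)) (reV (rot z Y)))

/-- The first differential of `|z|^r`. -/
noncomputable def powLin (r : ℝ) (z v : ℂ) : ℝ := r * ‖z‖ ^ (r - 2) * (‖z‖ * (phase z * v).re)

theorem sum_hess_norm_rpow (r : ℝ) (z : ℂ) (X Y : CVec d) :
    ∑ i, r * ‖z‖ ^ (r - 2) *
        ((X i * conj (Y i)).re + (r - 2) * ((phase z * X i).re * (phase z * Y i).re)) =
      powBil r z X Y := by
  rw [powBil, re_cdot, inner_reV_rot, ← Finset.mul_sum, Finset.sum_add_distrib, Finset.mul_sum]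

theorem powBil_smul_self (r : ℝ) (z : ℂ) (X c : CVec d) :
    powBil r z X (z • c) =
      r * ‖z‖ ^ (r - 2) * (‖z‖ * (cdot (opJ r c) (rot z X)).re) := by
  rw [powBil, ← cdot_rot z, rot_smul_self, re_cdot_real_smul_right, reV_real_smul,
    inner_smul_right, re_cdot_opJ_left, cdot_comm_re c, real_inner_comm]
  ring

theorem powLin_real_mul_self (r V : ℝ) (z : ℂ) :
    powLin r z (V * z) = r * ‖z‖ ^ (r - 2) * (V * ‖z‖ ^ 2) := by
  rw [powLin, mul_left_comm (phase z), phase_mul_self, ← Complex.ofReal_mul, Complex.ofReal_re]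
  ring

/-- The matrix, first-order and potential contributions of `|z|^r` add up to `quad`. -/
theorem powBil_add_powLin (r : ℝ) (a : Coeffs d) (z : ℂ) (X : CVec d) :
    powBil r z X (mulV a.A X) + powBil r z X (z • a.c) + powLin r z (cdot X (conjV a.b)) +
      powLin r z (a.V * z) = r * ‖z‖ ^ (r - 2) * quad r a ‖z‖ (rot z X) := by
  rw [powBil_smul_self, powLin_real_mul_self, powLin, phase_mul_cdot, powBil, ← cdot_rot z,
    rot_mulV, quad, re_cdot_opJ_right, cdot_add_left, Complex.add_re,
    cdot_comm_re (rot z X) (conjV a.b), cdot_comm_re (rot z X),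
    real_inner_comm (reV (rot z X))]
  ring

theorem HasHess.hessPair_eq {N : ℕ} {Φ : (Fin N → ℂ) → ℝ} {ω : Fin N → ℂ} {g : (Fin N → ℂ) → ℝ}
    {H : (Fin N → ℂ) → (Fin N → ℂ) → ℝ} (h : HasHess Φ ω g H) (Ξ Ξ' : Fin N → CVec d) :
    hessPair Φ ω Ξ Ξ' = ∑ i, H (fun j => Ξ j i) (fun j => Ξ' j i) :=
  Finset.sum_congr rfl fun _ _ => h.fderiv_fderiv_apply _ _

theorem hasHess_norm_rpow_apply {N : ℕ} (j : Fin N) {ω : Fin N → ℂ} {r : ℝ}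
    (h : ω j ≠ 0 ∨ 2 ≤ r) :
    HasHess (fun y : Fin N → ℂ => ‖y j‖ ^ r) ω (fun v => powLin r (ω j) (v j))
      (fun u v => r * ‖ω j‖ ^ (r - 2) *
        ((u j * conj (v j)).re + (r - 2) * ((phase (ω j) * u j).re * (phase (ω j) * v j).re))) :=
  HasHess.comp_clm (ContinuousLinearMap.proj (R := ℝ) (φ := fun _ : Fin N => ℂ) j)
    (hasHess_norm_rpow (z := ω j) h)

theorem mulV_one (X : CVec d) : mulV 1 X = X := by simp [mulV]

theorem hessPow_eq {r : ℝ} {z : ℂ} (h : z ≠ 0 ∨ 2 ≤ r) (X : CVec d) :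
    hessPow r z X = r * ‖z‖ ^ (r - 2) *
      ((r - 1) * ‖reV (rot z X)‖ ^ 2 + ‖imV (rot z X)‖ ^ 2) := by
  have hh : HasHess (powF r) ![z] _ _ := hasHess_norm_rpow_apply (0 : Fin 1) (ω := ![z]) h
  have e : hessPow r z X = powBil r z X X := by
    rw [hessPow, hessA, hh.hessPair_eq, ← sum_hess_norm_rpow]
    simp [mulV_one]
  rw [e, powBil, re_cdot_self, real_inner_self_eq_norm_sq, ← norm_rot z X,
    norm_sq_eq_reV_add_imV]
  ring

/-- Regroups `hessFull` for two variables. -/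
theorem hessFull_pair (Φ : (Fin 2 → ℂ) → ℝ) (a b : Coeffs d) (ζ η : ℂ) (X Y : CVec d) :
    hessFull Φ ![a, b] ![ζ, η] ![X, Y] =
      hessPair Φ ![ζ, η] ![X, Y] ![mulV a.A X, mulV b.A Y] +
      hessPair Φ ![ζ, η] ![X, Y] ![ζ • a.c, η • b.c] +
      fderiv ℝ Φ ![ζ, η] ![cdot X (conjV a.b), cdot Y (conjV b.b)] +
      fderiv ℝ Φ ![ζ, η] ![a.V * ζ, b.V * η] := by
  have e1 : (fun j => mulV ((![a, b] j).A) (![X, Y] j)) = ![mulV a.A X, mulV b.A Y] := by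
    funext j; fin_cases j <;> rfl
  have e2 : (fun j => (![ζ, η] j) • (![a, b] j).c) = ![ζ • a.c, η • b.c] := by
    funext j; fin_cases j <;> rfl
  have e3 : (fun j => cdot (![X, Y] j) (conjV (![a, b] j).b)) =
      ![cdot X (conjV a.b), cdot Y (conjV b.b)] := by
    funext j; fin_cases j <;> rfl
  have e4 : (fun j => (((![a, b] j).V : ℝ) : ℂ) * ![ζ, η] j) = ![a.V * ζ, b.V * η] := by
    funext j; fin_cases j <;> rfl
  rw [hessFull, hessA, hessBC, gradV, e1, e2, e3, e4]
  ring

theorem hessPair_add (Φ : (Fin 2 → ℂ) → ℝ) (ω : Fin 2 → ℂ) (Ξ Ξ' Ξ'' : Fin 2 → CVec d) :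
    hessPair Φ ω Ξ (Ξ' + Ξ'') = hessPair Φ ω Ξ Ξ' + hessPair Φ ω Ξ Ξ'' := by
  rw [hessPair, hessPair, hessPair, ← Finset.sum_add_distrib]
  refine Finset.sum_congr rfl fun i _ => ?_
  rw [← map_add]; rfl

/-- Removing scalar multiples of the identity from the matrices and a part of the potentials. -/
theorem hessFull_eq_perturbed (Φ : (Fin 2 → ℂ) → ℝ) (a b a' b' : Coeffs d) (k l v w : ℝ)
    (ζ η : ℂ) (X Y : CVec d)
    (haA : a'.A = a.A - (k : ℂ) • 1) (hab : a'.b = a.b) (hac : a'.c = a.c) (haV : a.V = a'.V + v)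
    (hbA : b'.A = b.A - (l : ℂ) • 1) (hbb : b'.b = b.b) (hbc : b'.c = b.c) (hbV : b.V = b'.V + w) :
    hessFull Φ ![a, b] ![ζ, η] ![X, Y] =
      hessFull Φ ![a', b'] ![ζ, η] ![X, Y] +
      hessPair Φ ![ζ, η] ![X, Y] ![(k : ℂ) • X, (l : ℂ) • Y] +
      gradV Φ ![v, w] ![ζ, η] := by
  have e1 : ![mulV a.A X, mulV b.A Y] =
      ![mulV a'.A X, mulV b'.A Y] + ![(k : ℂ) • X, (l : ℂ) • Y] := by
    rw [haA, hbA]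
    funext j; fin_cases j <;> simp [mulV, Matrix.sub_mulVec, Matrix.smul_mulVec]
  have e2 : ![(a.V : ℂ) * ζ, b.V * η] = ![(a'.V : ℂ) * ζ, b'.V * η] + ![(v : ℂ) * ζ, w * η] := by
    rw [haV, hbV]
    funext j; fin_cases j <;> simp [add_mul]
  have e3 : (fun j => ((![v, w] j : ℝ) : ℂ) * ![ζ, η] j) = ![(v : ℂ) * ζ, w * η] := by
    funext j; fin_cases j <;> rfl
  rw [hessFull_pair, hessFull_pair, e1, e2, hab, hac, hbb, hbc, hessPair_add, map_add, gradV, e3]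
  ring

end Evaluation

/-! ### The two branches of the Bellman function -/

section Branches

variable {d : ℕ}

theorem sum_pair_hess (r₀ r₁ k₀ k₁ : ℝ) (ζ η : ℂ) (X Y X' Y' : CVec d) :
    ∑ i, (k₀ * (r₀ * ‖ζ‖ ^ (r₀ - 2) * ((X i * conj (X' i)).re +
          (r₀ - 2) * ((phase ζ * X i).re * (phase ζ * X' i).re))) +
        k₁ * (r₁ * ‖η‖ ^ (r₁ - 2) * ((Y i * conj (Y' i)).re +
          (r₁ - 2) * ((phase η * Y i).re * (phase η * Y' i).re)))) =
      k₀ * powBil r₀ ζ X X' + k₁ * powBil r₁ η Y Y' := by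
  rw [← sum_hess_norm_rpow, ← sum_hess_norm_rpow, Finset.mul_sum, Finset.mul_sum,
    ← Finset.sum_add_distrib]

/-- In `|ζ|^p > |η|^q` the function `𝒬` is a combination of the two pure powers. -/
theorem hess_bellmanQ_of_gt {p q δ : ℝ} (hp : 2 ≤ p) (hq : q = p / (p - 1)) {ζ η : ℂ}
    (hη : η ≠ 0) (h : ‖η‖ ^ q < ‖ζ‖ ^ p) :
    (∀ X Y X' Y' : CVec d, hessPair (bellmanQ p δ) ![ζ, η] ![X, Y] ![X', Y'] =
      (1 + 2 * δ / p) * powBil p ζ X X' + (1 + δ * (2 / q - 1)) * powBil q η Y Y') ∧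
    ∀ u v : ℂ, fderiv ℝ (bellmanQ p δ) ![ζ, η] ![u, v] =
      (1 + 2 * δ / p) * powLin p ζ u + (1 + δ * (2 / q - 1)) * powLin q η v := by
  have h0 := (hasHess_norm_rpow_apply (0 : Fin 2) (ω := ![ζ, η]) (r := p)
    (Or.inr hp)).const_mul (1 + 2 * δ / p)
  have h1 := (hasHess_norm_rpow_apply (1 : Fin 2) (ω := ![ζ, η]) (r := q)
    (Or.inl hη)).const_mul (1 + δ * (2 / q - 1))
  have hq0 : 0 ≤ q := by rw [hq]; exact div_nonneg (by linarith) (by linarith)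
  have hev : ∀ᶠ y : Fin 2 → ℂ in 𝓝 ![ζ, η], ‖y 1‖ ^ q < ‖y 0‖ ^ p := by
    refine (isOpen_lt ?_ ?_).mem_nhds (x := ![ζ, η]) (by simpa using h)
    · exact (continuous_apply 1).norm.rpow_const fun _ => Or.inr hq0
    · exact (continuous_apply 0).norm.rpow_const fun _ => Or.inr (by linarith)
  have hh := (h0.add h1).congr (Ψ := bellmanQ p δ) (by
    filter_upwards [hev] with y hy
    simp only [bellmanQ, ← hq, if_neg (not_le.2 hy)]
    ring)
  refine ⟨fun X Y X' Y' => ?_, fun u v => hh.fderiv_apply _⟩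
  rw [hh.hessPair_eq, ← sum_pair_hess]
  rfl

/-- The second differential of `|ζ|² |η|^{2-q}`, tensored with the identity of `ℝ^d`, where
`T2 = |η|^{2-q}` and `ρ = |ζ| |η|^{1-q}`. -/
noncomputable def mixBil (q T2 ρ : ℝ) (ζ η : ℂ) (X Y X' Y' : CVec d) : ℝ :=
  2 * T2 * (cdot X X').re +
    2 * (2 - q) * ρ * (inner ℝ (reV (rot ζ X)) (reV (rot η Y')) +
      inner ℝ (reV (rot η Y)) (reV (rot ζ X'))) +
    (2 - q) * (ρ ^ 2 / T2) *
      ((cdot Y Y').re - q * inner ℝ (reV (rot η Y)) (reV (rot η Y')))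

/-- The first differential of `|ζ|² |η|^{2-q}`, in the parameters of `mixBil`. -/
noncomputable def mixLin (q T2 ρ : ℝ) (ζ η : ℂ) (u v : ℂ) : ℝ :=
  2 * T2 * (‖ζ‖ * (phase ζ * u).re) + (2 - q) * (ρ ^ 2 / T2) * (‖η‖ * (phase η * v).re)

/-- In `|ζ|^p < |η|^q` the function `𝒬` is the sum of the pure powers and a multiple of
`|ζ|² |η|^{2-q}`. -/
theorem hess_bellmanQ_of_lt {p q δ : ℝ} (hp : 2 ≤ p) (hq : q = p / (p - 1)) {ζ η : ℂ}
    (hη : η ≠ 0) (h : ‖ζ‖ ^ p < ‖η‖ ^ q) :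
    (∀ X Y X' Y' : CVec d, hessPair (bellmanQ p δ) ![ζ, η] ![X, Y] ![X', Y'] =
      powBil p ζ X X' + powBil q η Y Y' +
        δ * mixBil q (‖η‖ ^ (2 - q)) (‖ζ‖ * ‖η‖ ^ (1 - q)) ζ η X Y X' Y') ∧
    ∀ u v : ℂ, fderiv ℝ (bellmanQ p δ) ![ζ, η] ![u, v] =
      powLin p ζ u + powLin q η v +
        δ * mixLin q (‖η‖ ^ (2 - q)) (‖ζ‖ * ‖η‖ ^ (1 - q)) ζ η u v := by
  have h0 := (hasHess_norm_rpow_apply (0 : Fin 2) (ω := ![ζ, η]) (r := p)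
    (Or.inr hp))
  have h1 := (hasHess_norm_rpow_apply (1 : Fin 2) (ω := ![ζ, η]) (r := q)
    (Or.inl hη))
  have h2 := ((hasHess_norm_rpow_apply (0 : Fin 2) (ω := ![ζ, η]) (r := 2)
    (Or.inr le_rfl)).mul (hasHess_norm_rpow_apply (1 : Fin 2) (ω := ![ζ, η]) (r := 2 - q)
    (Or.inl hη))).const_mul δ
  have hq0 : 0 ≤ q := by rw [hq]; exact div_nonneg (by linarith) (by linarith)
  have hev : ∀ᶠ y : Fin 2 → ℂ in 𝓝 ![ζ, η], ‖y 0‖ ^ p < ‖y 1‖ ^ q := by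
    refine (isOpen_lt ?_ ?_).mem_nhds (x := ![ζ, η]) (by simpa using h)
    · exact (continuous_apply 0).norm.rpow_const fun _ => Or.inr (by linarith)
    · exact (continuous_apply 1).norm.rpow_const fun _ => Or.inr hq0
  have hh := ((h0.add h1).add h2).congr (Ψ := bellmanQ p δ) (by
    filter_upwards [hev] with y hy
    simp only [bellmanQ, ← hq, if_pos hy.le])
  have ht : 0 < ‖η‖ := norm_pos_iff.2 hη
  have e1 : ‖ζ‖ ^ (2 : ℝ) * ‖η‖ ^ (2 - q - 2) =
      (‖ζ‖ * ‖η‖ ^ (1 - q)) ^ 2 / ‖η‖ ^ (2 - q) := by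
    rw [eq_div_iff (by positivity), mul_assoc, ← Real.rpow_add ht, mul_pow,
      ← Real.rpow_natCast (‖η‖ ^ (1 - q)), ← Real.rpow_mul ht.le, Real.rpow_two]
    congr 2; push_cast; ring
  have e2 : ‖η‖ ^ (2 - q - 2) * ‖η‖ = ‖η‖ ^ (1 - q) := by
    rw [← Real.rpow_add_one ht.ne']; congr 1; ring
  have e3 : ‖ζ‖ ^ ((2 : ℝ) - 2) = 1 := by simp
  refine ⟨fun X Y X' Y' => ?_, fun u v => ?_⟩
  · rw [hh.hessPair_eq, mixBil, ← sum_hess_norm_rpow, ← sum_hess_norm_rpow, ← e1]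
    simp only [re_cdot, inner_reV_rot, Finset.mul_sum, ← Finset.sum_add_distrib,
      ← Finset.sum_sub_distrib]
    refine Finset.sum_congr rfl fun i _ => ?_
    simp only [powLin, Matrix.cons_val_zero, Matrix.cons_val_one, e3, ← e2]
    ring
  · rw [hh.fderiv_apply, mixLin, ← e1]
    simp only [powLin, Matrix.cons_val_zero, Matrix.cons_val_one, e3]
    ring

/-- The contribution of `|ζ|² |η|^{2-q}` to the generalized Hessian: the part in `ζ` is governed by
the form `quad 2`, the remaining terms are handled as perturbations. -/
theorem mixBil_add_mixLin (q T2 ρ : ℝ) (a b : Coeffs d) (ζ η : ℂ) (X Y : CVec d) :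
    mixBil q T2 ρ ζ η X Y (mulV a.A X) (mulV b.A Y) +
      mixBil q T2 ρ ζ η X Y (ζ • a.c) (η • b.c) +
      mixLin q T2 ρ ζ η (cdot X (conjV a.b)) (cdot Y (conjV b.b)) +
      mixLin q T2 ρ ζ η (a.V * ζ) (b.V * η) =
    2 * T2 * quad 2 a ‖ζ‖ (rot ζ X) +
      (2 - q) * (2 * ρ * (inner ℝ (reV (rot ζ X)) (reV (mulV b.A (rot η Y))) +
          inner ℝ (reV (rot η Y)) (reV (mulV a.A (rot ζ X))) +
          ‖η‖ * inner ℝ (reV (rot ζ X)) (reV b.c) + ‖ζ‖ * inner ℝ (reV (rot η Y)) (reV a.c)) +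
        ρ ^ 2 / T2 * ((cdot (rot η Y) (mulV b.A (rot η Y))).re
          - q * inner ℝ (reV (rot η Y)) (reV (mulV b.A (rot η Y)))
          + ‖η‖ * ((cdot (rot η Y) b.c).re - q * inner ℝ (reV (rot η Y)) (reV b.c))
          + ‖η‖ * (cdot (rot η Y) (conjV b.b)).re + b.V * ‖η‖ ^ 2)) := by
  rw [mixBil, mixBil, mixLin, mixLin, ← cdot_rot ζ X, ← cdot_rot ζ X, ← cdot_rot η Y,
    ← cdot_rot η Y, rot_smul_self, rot_smul_self, rot_mulV, rot_mulV, phase_mul_cdot,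
    phase_mul_cdot, mul_left_comm (phase ζ), mul_left_comm (phase η), phase_mul_self,
    phase_mul_self, ← Complex.ofReal_mul, ← Complex.ofReal_mul, Complex.ofReal_re,
    Complex.ofReal_re, quad, re_cdot_opJ_right, cdot_add_left, Complex.add_re,
    re_cdot_opJ_left, cdot_comm_re (conjV a.b), cdot_comm_re a.c, cdot_comm_re (mulV a.A _)]
  simp only [re_cdot_real_smul_right, reV_real_smul, inner_smul_right]
  ring

end Branches

/-! ### Bounds for the coefficients -/

section Bounds

variable {d : ℕ}

theorem norm_mulV_le {A : Matrix (Fin d) (Fin d) ℂ} {Lam : ℝ} (hLam : 0 ≤ Lam)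
    (h : ∀ ξ η : CVec d, ‖cdot (mulV A ξ) η‖ ≤ Lam * ‖ξ‖ * ‖η‖) (ξ : CVec d) :
    ‖mulV A ξ‖ ≤ Lam * ‖ξ‖ := by
  rcases (norm_nonneg (mulV A ξ)).eq_or_lt with h0 | hpos
  · rw [← h0]; positivity
  · have h2 : ‖mulV A ξ‖ ^ 2 ≤ Lam * ‖ξ‖ * ‖mulV A ξ‖ := by
      rw [← re_cdot_self]
      exact (Complex.re_le_norm _).trans (h ξ _)
    rw [sq] at h2
    exact le_of_mul_le_mul_right h2 hpos

/-- Two-sided control of `Γ_r` forces the first-order coefficient to be at most of the order of the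
square root of the potential. -/
theorem norm_firstOrder_le {r Lam : ℝ} (hLam : 0 < Lam) {a : Coeffs d}
    (hA : ∀ ξ η : CVec d, ‖cdot (mulV a.A ξ) η‖ ≤ Lam * ‖ξ‖ * ‖η‖) (hV : 0 ≤ a.V)
    (hG : ∀ ξ : CVec d, 0 ≤ Gam r a ξ) :
    ‖conjV a.b + opJ r a.c‖ ≤ 2 * √(Lam * (1 + |r - 2|)) * √a.V := by
  set e := conjV a.b + opJ r a.c with he
  set L := Lam * (1 + |r - 2|) with hL
  have hLpos : 0 < L := mul_pos hLam (by positivity)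
  have hquad : ∀ ξ : CVec d, (cdot (mulV a.A ξ) (opJ r ξ)).re ≤ L * ‖ξ‖ ^ 2 := by
    intro ξ
    have h1 := (Complex.abs_re_le_norm _).trans (hA ξ ξ)
    have h2 := (abs_inner_reV_le (mulV a.A ξ) ξ).trans
      (mul_le_mul_of_nonneg_right (norm_mulV_le hLam.le hA ξ) (norm_nonneg ξ))
    rw [re_cdot_opJ_right]
    have h3 : (r - 2) * inner ℝ (reV (mulV a.A ξ)) (reV ξ) ≤ |r - 2| * (Lam * ‖ξ‖ * ‖ξ‖) :=
      (le_abs_self _).trans (by rw [abs_mul]; exact mul_le_mul_of_nonneg_left h2 (abs_nonneg _))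
    have h4 := le_abs_self (cdot (mulV a.A ξ) ξ).re
    rw [hL]; nlinarith
  -- The choice `ξ = -e / (2 L)` minimizes the upper bound for `Γ_r`.
  have h := hG (((-(2 * L)⁻¹ : ℝ) : ℂ) • e)
  have h1 := hquad (((-(2 * L)⁻¹ : ℝ) : ℂ) • e)
  rw [Gam, ← he, re_cdot_real_smul_right, re_cdot_self] at h
  rw [norm_smul, Complex.norm_real, Real.norm_eq_abs, abs_neg, abs_of_pos (by positivity),
    mul_pow] at h1
  have h2 : ‖e‖ ^ 2 ≤ 4 * L * a.V := by
    have h3 : 0 ≤ L * (((2 * L)⁻¹) ^ 2 * ‖e‖ ^ 2) + -(2 * L)⁻¹ * ‖e‖ ^ 2 + a.V := by linarith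
    have h4 : L * (((2 * L)⁻¹) ^ 2 * ‖e‖ ^ 2) + -(2 * L)⁻¹ * ‖e‖ ^ 2 + a.V =
        (4 * L * a.V - ‖e‖ ^ 2) / (4 * L) := by field_simp; ring
    rw [h4] at h3
    by_contra hlt
    exact absurd (div_neg_of_neg_of_pos (by linarith : 4 * L * a.V - ‖e‖ ^ 2 < 0)
      (by positivity : 0 < 4 * L)) (not_lt.2 h3)
  refine le_of_sq_le_sq ?_ (by positivity)
  rw [mul_pow, mul_pow, Real.sq_sqrt hLpos.le, Real.sq_sqrt hV]
  linarith

theorem norm_le_norm_add_opJ {r : ℝ} (hr : 1 ≤ r) (c : CVec d) : ‖c‖ ≤ ‖c + opJ r c‖ := by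
  rw [EuclideanSpace.norm_eq, EuclideanSpace.norm_eq]
  refine Real.sqrt_le_sqrt (Finset.sum_le_sum fun i _ => ?_)
  rw [← Complex.normSq_eq_norm_sq, ← Complex.normSq_eq_norm_sq, Complex.normSq_apply,
    Complex.normSq_apply]
  have e1 : ((c + opJ r c) i).re = r * (c i).re := by simp [opJ]; ring
  have e2 : ((c + opJ r c) i).im = 2 * (c i).im := by simp [opJ]; ring
  rw [e1, e2]
  nlinarith [mul_nonneg (by nlinarith : 0 ≤ r ^ 2 - 1) (sq_nonneg (c i).re), sq_nonneg (c i).im]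

/-- The constant with which `|b|` and `|c|` are controlled by the square root of the potential. -/
noncomputable def coeffConst (r Lam M : ℝ) : ℝ := 2 * √(Lam * (1 + |r - 2|)) + 2 * M

theorem norm_coeff_le {r Lam M : ℝ} (hr : 1 ≤ r) (hLam : 0 < Lam) (hM : 0 ≤ M) {a : Coeffs d}
    (hA : ∀ ξ η : CVec d, ‖cdot (mulV a.A ξ) η‖ ≤ Lam * ‖ξ‖ * ‖η‖) (hV : 0 ≤ a.V)
    (hG : ∀ ξ : CVec d, 0 ≤ Gam r a ξ) (hbc : ‖conjV a.b - a.c‖ ≤ M * √a.V) :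
    ‖a.b‖ ≤ coeffConst r Lam M * √a.V ∧ ‖a.c‖ ≤ coeffConst r Lam M * √a.V := by
  have h1 := norm_firstOrder_le hLam hA hV hG
  have h2 : ‖a.c‖ ≤ ‖conjV a.b + opJ r a.c‖ + ‖conjV a.b - a.c‖ := by
    refine (norm_le_norm_add_opJ hr a.c).trans ?_
    have : a.c + opJ r a.c = (conjV a.b + opJ r a.c) - (conjV a.b - a.c) := by abel
    rw [this]; exact norm_sub_le _ _
  have h3 : ‖a.b‖ ≤ ‖conjV a.b - a.c‖ + ‖a.c‖ := by
    rw [← norm_conjV a.b]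
    simpa using norm_add_le (conjV a.b - a.c) a.c
  have h4 : 0 ≤ M * √a.V := by positivity
  unfold coeffConst
  constructor <;> linarith

end Bounds

/-! ### The exponents and the weight -/

section Exponents

variable {p q : ℝ}

theorem conj_exponent_bounds (hp : 2 ≤ p) (hq : q = p / (p - 1)) :
    1 < q ∧ q ≤ 2 ∧ p * q = p + q ∧ 4 ≤ p * q := by
  have h1 : 0 < p - 1 := by linarith
  subst hq
  refine ⟨(one_lt_div h1).2 (by linarith), (div_le_iff₀ h1).2 (by linarith), ?_, ?_⟩
  · field_simp; ring
  · rw [← mul_div_assoc, le_div_iff₀ h1]; nlinarith [sq_nonneg (p - 2)]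

theorem rpow_conj_sub_one (hp : 2 ≤ p) (hq : q = p / (p - 1)) {t : ℝ} (ht : 0 ≤ t) :
    (t ^ (q - 1)) ^ p = t ^ q := by
  rw [← Real.rpow_mul ht]
  congr 1
  linarith [(conj_exponent_bounds hp hq).2.2.1]

theorem rpow_conj_sub_one' (hp : 2 ≤ p) (hq : q = p / (p - 1)) {t : ℝ} (ht : 0 ≤ t) :
    (t ^ (q - 1)) ^ (p - 2) = t ^ (2 - q) := by
  rw [← Real.rpow_mul ht]
  congr 1
  linarith [(conj_exponent_bounds hp hq).2.2.1]

theorem le_of_rpow_lt (hp : 2 ≤ p) (hq : q = p / (p - 1)) {s t : ℝ} (hs : 0 ≤ s) (ht : 0 ≤ t)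
    (h : s ^ p < t ^ q) : s ≤ t ^ (q - 1) := by
  rw [← rpow_conj_sub_one hp hq ht] at h
  exact (Real.rpow_lt_rpow_iff hs (by positivity) (by linarith)).1 h |>.le

theorem ge_of_rpow_lt (hp : 2 ≤ p) (hq : q = p / (p - 1)) {s t : ℝ} (hs : 0 ≤ s) (ht : 0 ≤ t)
    (h : t ^ q < s ^ p) : t ^ (q - 1) ≤ s := by
  rw [← rpow_conj_sub_one hp hq ht] at h
  exact (Real.rpow_lt_rpow_iff (by positivity) hs (by linarith)).1 h |>.le

theorem tau_of_lt (hp : 2 ≤ p) (hq : q = p / (p - 1)) {ζ η : ℂ} (h : ‖ζ‖ ^ p < ‖η‖ ^ q) :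
    tau p (ζ, η) = ‖η‖ ^ (2 - q) := by
  have h1 := le_of_rpow_lt hp hq (norm_nonneg _) (norm_nonneg _) h
  rw [tau, ← hq, ← rpow_conj_sub_one' hp hq (norm_nonneg η)]
  exact max_eq_right (Real.rpow_le_rpow (norm_nonneg _) h1 (by linarith))

theorem tau_of_gt (hp : 2 ≤ p) (hq : q = p / (p - 1)) {ζ η : ℂ} (h : ‖η‖ ^ q < ‖ζ‖ ^ p) :
    tau p (ζ, η) = ‖ζ‖ ^ (p - 2) ∧ ‖η‖ ^ (2 - q) ≤ ‖ζ‖ ^ (p - 2) := by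
  have h1 := ge_of_rpow_lt hp hq (norm_nonneg _) (norm_nonneg _) h
  have h2 : ‖η‖ ^ (2 - q) ≤ ‖ζ‖ ^ (p - 2) := by
    rw [← rpow_conj_sub_one' hp hq (norm_nonneg η)]
    exact Real.rpow_le_rpow (by positivity) h1 (by linarith)
  refine ⟨?_, h2⟩
  rw [tau, ← hq]
  exact max_eq_left h2

theorem continuous_tau (hp : 2 ≤ p) : Continuous (tau p) := by
  have h := (conj_exponent_bounds hp rfl).2.1
  refine Continuous.max ?_ ?_
  · exact continuous_fst.norm.rpow_const fun _ => Or.inr (by linarith)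
  · exact continuous_snd.norm.rpow_const fun _ => Or.inr (by linarith)

theorem tau_nonneg (p : ℝ) (ω : ℂ × ℂ) : 0 ≤ tau p ω :=
  le_max_of_le_left (by positivity)

theorem tau_pos (p : ℝ) {ω : ℂ × ℂ} (h : ω ≠ (0, 0)) : 0 < tau p ω := by
  by_cases h1 : ω.1 = 0
  · have h2 : ω.2 ≠ 0 := fun h2 => h (Prod.ext h1 h2)
    exact lt_max_of_lt_right (Real.rpow_pos_of_pos (norm_pos_iff.2 h2) _)
  · exact lt_max_of_lt_left (Real.rpow_pos_of_pos (norm_pos_iff.2 h1) _)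

theorem locallyIntegrableOn_tau_inv (hp : 2 ≤ p) :
    LocallyIntegrableOn (fun ω => (tau p ω)⁻¹) ({(0, 0)}ᶜ : Set (ℂ × ℂ)) volume :=
  ContinuousOn.locallyIntegrableOn
    ((continuous_tau hp).continuousOn.inv₀ fun _ h => (tau_pos p h).ne')
    (measurableSet_singleton _).compl

end Exponents

/-! ### Lower bounds off the exceptional set -/

section LowerBounds

variable {d : ℕ}

/-- Absorption of the mixed terms: for small `δ` the good terms of size `m` in `y`, `w` and of size
`δ` in `x`, `v` dominate the mixed terms, which all carry the factor `δ` and contain `y` or `w`. -/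
theorem absorb {x v y w μ m K δ : ℝ} (hμ : 0 < μ) (hδ : 0 ≤ δ) (hK : 0 ≤ K)
    (h : δ * (K ^ 2 / μ + 2 * K) ≤ m / 2) :
    δ * μ * (x ^ 2 + v ^ 2) + m / 2 * (y ^ 2 + w ^ 2) ≤
      m * (y ^ 2 + w ^ 2) +
        δ * (2 * μ * (x ^ 2 + v ^ 2) - K * (x * y + x * w + v * y + y * w + y ^ 2)) := by
  have young : ∀ a b : ℝ, K * (a * b) ≤ μ / 2 * a ^ 2 + K ^ 2 / μ / 2 * b ^ 2 := by
    intro a b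
    have e : μ / 2 * a ^ 2 + K ^ 2 / μ / 2 * b ^ 2 - K * (a * b) = (μ * a - K * b) ^ 2 / (2 * μ) := by
      field_simp; ring
    have : 0 ≤ (μ * a - K * b) ^ 2 / (2 * μ) := by positivity
    linarith
  have hyw : K * (y * w) ≤ K / 2 * (y ^ 2 + w ^ 2) := by
    nlinarith [mul_nonneg hK (sq_nonneg (y - w))]
  have hvw : 0 ≤ μ / 2 * v ^ 2 := by positivity
  have hw : 0 ≤ K ^ 2 / μ / 2 * w ^ 2 := by positivity
  have hKw : 0 ≤ K * w ^ 2 := by positivity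
  have hKy : 0 ≤ K * y ^ 2 := by positivity
  have hsum : K * (x * y + x * w + v * y + y * w + y ^ 2) ≤
      μ * (x ^ 2 + v ^ 2) + (K ^ 2 / μ + 2 * K) * (y ^ 2 + w ^ 2) := by
    nlinarith [young x y, young x w, young v y]
  have h1 := mul_le_mul_of_nonneg_left hsum hδ
  have h2 := mul_le_mul_of_nonneg_right h (by positivity : 0 ≤ y ^ 2 + w ^ 2)
  nlinarith

theorem powBil_real_smul (k r : ℝ) {z : ℂ} (h : z ≠ 0 ∨ 2 ≤ r) (X : CVec d) :
    powBil r z X ((k : ℂ) • X) = k * hessPow r z X := by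
  have e : rot z ((k : ℂ) • X) = (k : ℂ) • rot z X := smul_comm _ _ _
  rw [hessPow_eq h, powBil, re_cdot_real_smul_right, e, reV_real_smul, inner_smul_right,
    re_cdot_self, real_inner_self_eq_norm_sq, ← norm_rot z X, norm_sq_eq_reV_add_imV]
  ring

/-- The bound in the region `|ζ|^p > |η|^q`, where `𝒬` is a combination of pure powers. -/
theorem lower_bound_of_gt {p q δ α₁ α₂ μp μq : ℝ} (hp : 2 ≤ p) (hq : q = p / (p - 1))
    (hδ : 0 ≤ δ) (hα₁ : 0 ≤ α₁) (hμp : 0 ≤ μp) (hμq : 0 ≤ μq)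
    {a b : Coeffs d} (haV : 0 ≤ a.V) (hbV : 0 ≤ b.V)
    (ha : ∀ ξ : CVec d, μp * (‖ξ‖ ^ 2 + a.V) ≤ Gam p a ξ)
    (hb : ∀ ξ : CVec d, μq * (‖ξ‖ ^ 2 + b.V) ≤ Gam q b ξ)
    {ζ η : ℂ} (hη : η ≠ 0) (h : ‖η‖ ^ q < ‖ζ‖ ^ p) (X Y : CVec d) :
    μp * (‖ζ‖ ^ (p - 2) * (‖X‖ ^ 2 + a.V * ‖ζ‖ ^ 2)) +
        μq * (‖η‖ ^ (q - 2) * (‖Y‖ ^ 2 + b.V * ‖η‖ ^ 2)) +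
        α₁ * (p * q / 4 * hessPow p ζ X + 2 * δ * hFun p ζ η X Y) +
        α₂ * (q + (2 - q) * δ) * (p / 4) * hessPow q η Y ≤
      hessFull (bellmanQ p δ) ![a, b] ![ζ, η] ![X, Y] +
        hessPair (bellmanQ p δ) ![ζ, η] ![X, Y]
          ![((α₁ * (p * q / 4) : ℝ) : ℂ) • X, ((α₂ * (p * q / 4) : ℝ) : ℂ) • Y] := by
  obtain ⟨hq1, hq2, hpq, hpq4⟩ := conj_exponent_bounds hp hq
  obtain ⟨hB, hL⟩ := hess_bellmanQ_of_gt (d := d) (δ := δ) hp hq hη h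
  have hfull : hessFull (bellmanQ p δ) ![a, b] ![ζ, η] ![X, Y] =
      (1 + 2 * δ / p) * (p * ‖ζ‖ ^ (p - 2) * quad p a ‖ζ‖ (rot ζ X)) +
        (1 + δ * (2 / q - 1)) * (q * ‖η‖ ^ (q - 2) * quad q b ‖η‖ (rot η Y)) := by
    rw [hessFull_pair, hB, hB, hL, hL, ← powBil_add_powLin, ← powBil_add_powLin]
    ring
  have hqa := le_quad ha (norm_nonneg ζ) (rot ζ X)
  have hqb := le_quad hb (norm_nonneg η) (rot η Y)
  rw [norm_rot] at hqa hqb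
  have hka : 0 ≤ 2 * δ / p := by positivity
  have hkb : 0 ≤ δ * (2 / q - 1) :=
    mul_nonneg hδ (by rw [sub_nonneg, one_le_div (by linarith)]; exact hq2)
  have ha0 : 0 ≤ ‖X‖ ^ 2 + a.V * ‖ζ‖ ^ 2 := by positivity
  have hb0 : 0 ≤ ‖Y‖ ^ 2 + b.V * ‖η‖ ^ 2 := by positivity
  have h1 : μp * (‖ζ‖ ^ (p - 2) * (‖X‖ ^ 2 + a.V * ‖ζ‖ ^ 2)) ≤
      (1 + 2 * δ / p) * (p * ‖ζ‖ ^ (p - 2) * quad p a ‖ζ‖ (rot ζ X)) := by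
    have hs : 0 ≤ ‖ζ‖ ^ (p - 2) := by positivity
    have hc : 1 ≤ (1 + 2 * δ / p) * p := by nlinarith
    have := mul_le_mul hc hqa (by positivity) (by positivity)
    nlinarith [mul_le_mul_of_nonneg_left this hs]
  have h2 : μq * (‖η‖ ^ (q - 2) * (‖Y‖ ^ 2 + b.V * ‖η‖ ^ 2)) ≤
      (1 + δ * (2 / q - 1)) * (q * ‖η‖ ^ (q - 2) * quad q b ‖η‖ (rot η Y)) := by
    have hs : 0 ≤ ‖η‖ ^ (q - 2) := by positivity
    have hc : 1 ≤ (1 + δ * (2 / q - 1)) * q := by nlinarith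
    have := mul_le_mul hc hqb (by positivity) (by linarith)
    nlinarith [mul_le_mul_of_nonneg_left this hs]
  -- The real parts agree exactly, since `q (p - 1) = p`; the imaginary parts use `p q ≥ 4`.
  have hh : hFun p ζ η X Y ≤ q / 4 * hessPow p ζ X := by
    rw [hFun, ← hq, if_neg (not_lt.2 h.le), gFun, hessPow_eq (Or.inr hp)]
    have e : q / 4 * (p * ‖ζ‖ ^ (p - 2) *
          ((p - 1) * ‖reV (rot ζ X)‖ ^ 2 + ‖imV (rot ζ X)‖ ^ 2)) -
        p / 2 * ‖ζ‖ ^ (p - 2) * (p / 2 * ‖reV (rot ζ X)‖ ^ 2 + 2 / p * ‖imV (rot ζ X)‖ ^ 2) =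
        (p * q / 4 - 1) * (‖ζ‖ ^ (p - 2) * ‖imV (rot ζ X)‖ ^ 2) := by
      have hq' : q * (p - 1) = p := by linarith
      have hp' : p / 2 * (2 / p) = 1 := by field_simp
      linear_combination (‖ζ‖ ^ (p - 2)) * ((p / 4 * ‖reV (rot ζ X)‖ ^ 2) * hq'
        - ‖imV (rot ζ X)‖ ^ 2 * hp')
    have : 0 ≤ (p * q / 4 - 1) * (‖ζ‖ ^ (p - 2) * ‖imV (rot ζ X)‖ ^ 2) :=
      mul_nonneg (by linarith) (by positivity)
    linarith
  have h3 := mul_le_mul_of_nonneg_left hh (mul_nonneg hα₁ hδ)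
  have e1 : (1 + 2 * δ / p) * (α₁ * (p * q / 4)) = α₁ * (p * q / 4) + α₁ * δ * 2 * (q / 4) := by
    field_simp
  have e2 : (1 + δ * (2 / q - 1)) * (α₂ * (p * q / 4)) = α₂ * (q + (2 - q) * δ) * (p / 4) := by
    field_simp
  rw [hfull, hB, powBil_real_smul _ _ (Or.inr hp), powBil_real_smul _ _ (Or.inl hη),
    ← mul_assoc _ (α₁ * (p * q / 4)), ← mul_assoc _ (α₂ * (p * q / 4)), e1, e2]
  linarith

/-- The perturbation terms of `mixBil_add_mixLin` in the natural variables
`x = T|X|`, `v = T|ζ|√V`, `y = |Y|/T`, `w = |η|√W/T`, where `T² = |η|^{2-q}`. -/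
theorem mixed_terms_lower_bound {q T ρ K s t : ℝ} (hq1 : 1 < q) (hq2 : q ≤ 2) (hT : 0 < T)
    (hρ : 0 ≤ ρ) (hρ1 : ρ ≤ 1) (hK : 0 ≤ K) (hs : 0 ≤ s) (ht : 0 ≤ t)
    {a b : Coeffs d} (hbV : 0 ≤ b.V)
    (haA : ∀ ξ : CVec d, ‖mulV a.A ξ‖ ≤ K * ‖ξ‖) (hbA : ∀ ξ : CVec d, ‖mulV b.A ξ‖ ≤ K * ‖ξ‖)
    (hac : ‖a.c‖ ≤ K * √a.V) (hbb : ‖b.b‖ ≤ K * √b.V) (hbc : ‖b.c‖ ≤ K * √b.V)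
    (ξ υ : CVec d) :
    -(4 * K * ((T * ‖ξ‖) * (‖υ‖ / T) + (T * ‖ξ‖) * (t * √b.V / T) +
        (T * (s * √a.V)) * (‖υ‖ / T) + (‖υ‖ / T) * (t * √b.V / T) + (‖υ‖ / T) ^ 2)) ≤
      (2 - q) * (2 * ρ * (inner ℝ (reV ξ) (reV (mulV b.A υ)) +
          inner ℝ (reV υ) (reV (mulV a.A ξ)) +
          t * inner ℝ (reV ξ) (reV b.c) + s * inner ℝ (reV υ) (reV a.c)) +
        ρ ^ 2 / T ^ 2 * ((cdot υ (mulV b.A υ)).re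
          - q * inner ℝ (reV υ) (reV (mulV b.A υ))
          + t * ((cdot υ b.c).re - q * inner ℝ (reV υ) (reV b.c))
          + t * (cdot υ (conjV b.b)).re + b.V * t ^ 2)) := by
  set Va := √a.V
  set Vb := √b.V
  have hVa : 0 ≤ Va := Real.sqrt_nonneg _
  have hVb : 0 ≤ Vb := Real.sqrt_nonneg _
  have hξ := norm_nonneg ξ
  have hυ := norm_nonneg υ
  have b1 : |inner ℝ (reV ξ) (reV (mulV b.A υ))| ≤ K * (‖ξ‖ * ‖υ‖) :=
    (abs_inner_reV_le _ _).trans ((mul_le_mul_of_nonneg_left (hbA υ) hξ).trans_eq (by ring))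
  have b2 : |inner ℝ (reV υ) (reV (mulV a.A ξ))| ≤ K * (‖ξ‖ * ‖υ‖) :=
    (abs_inner_reV_le _ _).trans ((mul_le_mul_of_nonneg_left (haA ξ) hυ).trans_eq (by ring))
  have b3 : |inner ℝ (reV ξ) (reV b.c)| ≤ K * (‖ξ‖ * Vb) :=
    (abs_inner_reV_le _ _).trans ((mul_le_mul_of_nonneg_left hbc hξ).trans_eq (by ring))
  have b4 : |inner ℝ (reV υ) (reV a.c)| ≤ K * (‖υ‖ * Va) :=
    (abs_inner_reV_le _ _).trans ((mul_le_mul_of_nonneg_left hac hυ).trans_eq (by ring))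
  have b5 : |(cdot υ (mulV b.A υ)).re| ≤ K * (‖υ‖ * ‖υ‖) :=
    (abs_re_cdot_le _ _).trans ((mul_le_mul_of_nonneg_left (hbA υ) hυ).trans_eq (by ring))
  have b6 : |inner ℝ (reV υ) (reV (mulV b.A υ))| ≤ K * (‖υ‖ * ‖υ‖) :=
    (abs_inner_reV_le _ _).trans ((mul_le_mul_of_nonneg_left (hbA υ) hυ).trans_eq (by ring))
  have b7 : |(cdot υ b.c).re| ≤ K * (‖υ‖ * Vb) :=
    (abs_re_cdot_le _ _).trans ((mul_le_mul_of_nonneg_left hbc hυ).trans_eq (by ring))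
  have b8 : |inner ℝ (reV υ) (reV b.c)| ≤ K * (‖υ‖ * Vb) :=
    (abs_inner_reV_le _ _).trans ((mul_le_mul_of_nonneg_left hbc hυ).trans_eq (by ring))
  have b9 : |(cdot υ (conjV b.b)).re| ≤ K * (‖υ‖ * Vb) :=
    (abs_re_cdot_le _ _).trans
      ((mul_le_mul_of_nonneg_left ((norm_conjV b.b).trans_le hbb) hυ).trans_eq (by ring))
  generalize inner ℝ (reV ξ) (reV (mulV b.A υ)) = i1 at *
  generalize inner ℝ (reV υ) (reV (mulV a.A ξ)) = i2 at *
  generalize inner ℝ (reV ξ) (reV b.c) = i3 at *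
  generalize inner ℝ (reV υ) (reV a.c) = i4 at *
  generalize (cdot υ (mulV b.A υ)).re = i5 at *
  generalize inner ℝ (reV υ) (reV (mulV b.A υ)) = i6 at *
  generalize (cdot υ b.c).re = i7 at *
  generalize inner ℝ (reV υ) (reV b.c) = i8 at *
  generalize (cdot υ (conjV b.b)).re = i9 at *
  generalize ‖ξ‖ = x at *
  generalize ‖υ‖ = y at *
  rw [abs_le] at b1 b2 b3 b4 b5 b6 b7 b8 b9
  -- Both brackets are bounded below before the factors `ρ, ρ² ≤ 1` and `2 - q ≤ 1` are dropped.
  have c1 : -(K * (2 * (x * y) + t * (x * Vb) + s * (y * Va))) ≤ i1 + i2 + t * i3 + s * i4 := by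
    have := mul_le_mul_of_nonneg_left b3.1 ht
    have := mul_le_mul_of_nonneg_left b4.1 hs
    linarith [b1.1, b2.1]
  have hq0 : 0 ≤ q := by linarith
  have c2 : -(K * (3 * (y * y) + 4 * (t * (y * Vb)))) ≤
      i5 - q * i6 + t * (i7 - q * i8) + t * i9 + b.V * t ^ 2 := by
    have d1 : q * i6 ≤ 2 * (K * (y * y)) :=
      (mul_le_mul_of_nonneg_left b6.2 hq0).trans
        (mul_le_mul_of_nonneg_right hq2 (by positivity))
    have d2 : q * i8 ≤ 2 * (K * (y * Vb)) :=
      (mul_le_mul_of_nonneg_left b8.2 hq0).trans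
        (mul_le_mul_of_nonneg_right hq2 (by positivity))
    have d3 : -(4 * (K * (y * Vb))) ≤ i7 - q * i8 + i9 := by linarith [b7.1, b9.1]
    have := mul_le_mul_of_nonneg_left d3 ht
    have : 0 ≤ b.V * t ^ 2 := by positivity
    linarith [b5.1]
  have hρT : 0 ≤ ρ ^ 2 / T ^ 2 := by positivity
  have hρT1 : ρ ^ 2 / T ^ 2 ≤ 1 / T ^ 2 := by
    gcongr; exact pow_le_one₀ hρ hρ1
  obtain ⟨R1, hR1⟩ : ∃ R1, R1 = K * (2 * (x * y) + t * (x * Vb) + s * (y * Va)) := ⟨_, rfl⟩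
  obtain ⟨R2, hR2⟩ : ∃ R2, R2 = K * (3 * (y * y) + 4 * (t * (y * Vb))) := ⟨_, rfl⟩
  have hR1n : 0 ≤ R1 := by rw [hR1]; positivity
  have hR2n : 0 ≤ R2 := by rw [hR2]; positivity
  rw [← hR1] at c1
  rw [← hR2] at c2
  have f1 : -(2 * R1) ≤ 2 * ρ * (i1 + i2 + t * i3 + s * i4) := by
    refine le_trans ?_ (mul_le_mul_of_nonneg_left c1 (by positivity : 0 ≤ 2 * ρ))
    linarith [mul_le_mul_of_nonneg_right hρ1 hR1n]
  have f2 : -(1 / T ^ 2 * R2) ≤ ρ ^ 2 / T ^ 2 *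
      (i5 - q * i6 + t * (i7 - q * i8) + t * i9 + b.V * t ^ 2) := by
    refine le_trans ?_ (mul_le_mul_of_nonneg_left c2 hρT)
    linarith [mul_le_mul_of_nonneg_right hρT1 hR2n]
  have f3 : 2 * R1 + 1 / T ^ 2 * R2 ≤ 4 * K * ((T * x) * (y / T) + (T * x) * (t * Vb / T) +
        (T * (s * Va)) * (y / T) + (y / T) * (t * Vb / T) + (y / T) ^ 2) := by
    have e1 : (T * x) * (y / T) = x * y := by field_simp
    have e2 : (T * x) * (t * Vb / T) = t * (x * Vb) := by field_simp
    have e3 : (T * (s * Va)) * (y / T) = s * (y * Va) := by field_simp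
    have e4 : (y / T) * (t * Vb / T) = 1 / T ^ 2 * (t * (y * Vb)) := by field_simp
    have e5 : (y / T) ^ 2 = 1 / T ^ 2 * (y * y) := by field_simp
    rw [e1, e2, e3, e4, e5, hR1, hR2]
    have g1 : 0 ≤ K * (t * (x * Vb)) := by positivity
    have g2 : 0 ≤ K * (s * (y * Va)) := by positivity
    have g3 : 0 ≤ K * (1 / T ^ 2 * (y * y)) := by positivity
    linarith
  have hF : 0 ≤ 2 * R1 + 1 / T ^ 2 * R2 := by positivity
  have h2q : 0 ≤ 2 - q := by linarith
  refine le_trans ?_ (mul_le_mul_of_nonneg_left (add_le_add f1 f2) h2q)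
  linarith [mul_le_mul_of_nonneg_right (by linarith : 2 - q ≤ 1) hF]

/-- The scalar perturbation `(α₁, α₂) pq/4` of the matrices, tested on `|ζ|² |η|^{2-q}`: it exceeds
the corresponding terms of the claim up to mixed terms that can be absorbed. -/
theorem scalar_perturbation_lower_bound {p q T ρ α₁ α₂ : ℝ} (hq1 : 1 < q) (hq2 : q ≤ 2)
    (hpq4 : 4 ≤ p * q) (hT : 0 < T) (hρ : 0 ≤ ρ) (hρ1 : ρ ≤ 1) (hα₁ : 0 ≤ α₁) (hα₂ : 0 ≤ α₂)
    (ζ η : ℂ) (X Y : CVec d) :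
    α₁ * 2 * (T ^ 2 * ‖X‖ ^ 2 + (1 - q / 2) ^ 2 * (ρ ^ 2 / T ^ 2) * ‖reV (rot η Y)‖ ^ 2 +
          2 * (1 - q / 2) * ρ * inner ℝ (reV (rot ζ X)) (reV (rot η Y))) +
        α₂ * (2 - q) * (p / 4) * (q * (T ^ 2)⁻¹ *
          ((q - 1) * ‖reV (rot η Y)‖ ^ 2 + ‖imV (rot η Y)‖ ^ 2)) -
        p * q * (α₁ + α₂) * ((T * ‖X‖) * (‖Y‖ / T) + (‖Y‖ / T) ^ 2) ≤
      mixBil q (T ^ 2) ρ ζ η X Y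
        (((α₁ * (p * q / 4) : ℝ) : ℂ) • X) (((α₂ * (p * q / 4) : ℝ) : ℂ) • Y) := by
  have e1 : rot ζ (((α₁ * (p * q / 4) : ℝ) : ℂ) • X) =
      ((α₁ * (p * q / 4) : ℝ) : ℂ) • rot ζ X := smul_comm _ _ _
  have e2 : rot η (((α₂ * (p * q / 4) : ℝ) : ℂ) • Y) =
      ((α₂ * (p * q / 4) : ℝ) : ℂ) • rot η Y := smul_comm _ _ _
  have hin : |inner ℝ (reV (rot ζ X)) (reV (rot η Y))| ≤ ‖X‖ * ‖Y‖ := by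
    simpa [norm_rot] using abs_inner_reV_le (rot ζ X) (rot η Y)
  have hY : ‖Y‖ ^ 2 = ‖reV (rot η Y)‖ ^ 2 + ‖imV (rot η Y)‖ ^ 2 := by
    rw [← norm_sq_eq_reV_add_imV, norm_rot]
  rw [mixBil, e1, e2, re_cdot_real_smul_right, re_cdot_real_smul_right, reV_real_smul,
    reV_real_smul, inner_smul_right, inner_smul_right, inner_smul_right, re_cdot_self,
    re_cdot_self, real_inner_self_eq_norm_sq, real_inner_comm (reV (rot ζ X)) (reV (rot η Y))]
  have e3 : (T * ‖X‖) * (‖Y‖ / T) = ‖X‖ * ‖Y‖ := by field_simp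
  have e4 : (‖Y‖ / T) ^ 2 = (T ^ 2)⁻¹ * ‖Y‖ ^ 2 := by field_simp
  rw [e3, e4, hY, div_eq_mul_inv (ρ ^ 2)]
  have hXY : 0 ≤ ‖X‖ * ‖Y‖ := by positivity
  generalize inner ℝ (reV (rot ζ X)) (reV (rot η Y)) = i at *
  generalize ‖X‖ * ‖Y‖ = xy at *
  have hre : 0 ≤ ‖reV (rot η Y)‖ ^ 2 := by positivity
  have him : 0 ≤ ‖imV (rot η Y)‖ ^ 2 := by positivity
  generalize ‖reV (rot η Y)‖ ^ 2 = u at *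
  generalize ‖imV (rot η Y)‖ ^ 2 = v at *
  have hx : 0 ≤ T ^ 2 * ‖X‖ ^ 2 := by positivity
  have hτ : 0 ≤ (T ^ 2)⁻¹ := by positivity
  generalize (T ^ 2)⁻¹ = τ at *
  obtain ⟨P, hP⟩ : ∃ P, P = p * q := ⟨_, rfl⟩
  rw [← hP] at hpq4
  have h2q : 0 ≤ 2 - q := by linarith
  have h2q1 : 2 - q ≤ 1 := by linarith
  have hρ2 : ρ ^ 2 ≤ 1 := pow_le_one₀ hρ hρ1
  have hP1 : α₁ ≤ P / 4 * (α₁ + α₂) := by nlinarith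
  have g1 : α₁ * 2 * (T ^ 2 * ‖X‖ ^ 2) ≤ P / 4 * (α₁ * 2 * (T ^ 2 * ‖X‖ ^ 2)) :=
    le_mul_of_one_le_left (by positivity) (by linarith)
  have g2 : -(P * (α₁ + α₂) * xy) ≤ 2 * (2 - q) * ρ * (P / 4 * (α₁ + α₂) - α₁) * i := by
    have hc : 0 ≤ 2 * (2 - q) * ρ * (P / 4 * (α₁ + α₂) - α₁) := by
      have : 0 ≤ P / 4 * (α₁ + α₂) - α₁ := by linarith
      positivity
    have hc1 : 2 * (2 - q) * ρ * (P / 4 * (α₁ + α₂) - α₁) ≤ P * (α₁ + α₂) := by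
      have h1 : (2 - q) * ρ ≤ 1 := mul_le_one₀ h2q1 hρ hρ1
      have h2 : 0 ≤ P / 4 * (α₁ + α₂) - α₁ := by linarith
      have h3 := mul_le_mul_of_nonneg_right h1 h2
      have h4 : 0 ≤ P * (α₁ + α₂) := by positivity
      linarith
    have h1 := mul_le_mul_of_nonneg_left (abs_le.1 hin).1 hc
    have h2 := mul_le_mul_of_nonneg_right hc1 hXY
    linarith
  have g3 : 2 * α₁ * ((1 - q / 2) ^ 2 * ρ ^ 2) * u +
        α₂ * (P / 4) * ((2 - q) * (q - 1) * u + (2 - q) * v) -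
      P * (α₁ + α₂) * (u + v) ≤ α₂ * (P / 4) * ((2 - q) * ρ ^ 2 * (v - (q - 1) * u)) := by
    have h1 : (1 - q / 2) ^ 2 * ρ ^ 2 ≤ 1 :=
      mul_le_one₀ (pow_le_one₀ (by linarith) (by linarith)) (by positivity) hρ2
    have h2 : (2 - q) * (q - 1) ≤ 1 := by nlinarith
    have h3 : (2 - q) * ρ ^ 2 * (q - 1) ≤ 1 := by
      rw [mul_right_comm]
      exact mul_le_one₀ h2 (by positivity) hρ2
    have h4 : 0 ≤ (2 - q) * ρ ^ 2 * v := by positivity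
    have h5 := mul_le_mul_of_nonneg_left h1 (by positivity : 0 ≤ 2 * α₁ * u)
    have h6 : (2 - q) * (q - 1) * u + (2 - q) * v - (2 - q) * ρ ^ 2 * (v - (q - 1) * u) ≤
        2 * u + v := by
      have := mul_le_mul_of_nonneg_right h2 hre
      have := mul_le_mul_of_nonneg_right h3 hre
      have := mul_le_mul_of_nonneg_right h2q1 him
      linarith
    have h7 := mul_le_mul_of_nonneg_left h6 (by positivity : 0 ≤ α₂ * (P / 4))
    have h8 := mul_le_mul_of_nonneg_right hpq4 (by positivity : 0 ≤ α₁ * u)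
    have h9 : 0 ≤ P * α₁ * v := by positivity
    have h10 : 0 ≤ P * α₂ * u := by positivity
    have h11 : 0 ≤ P * α₂ * v := by positivity
    have h12 : 0 ≤ α₁ * u := by positivity
    linarith
  have g4 := mul_le_mul_of_nonneg_left g3 hτ
  rw [show α₂ * (2 - q) * (p / 4) * (q * τ * ((q - 1) * u + v)) =
    α₂ * (2 - q) * (P / 4) * (τ * ((q - 1) * u + v)) by rw [hP]; ring, ← hP]
  linarith

/-- The bound in the region `|ζ|^p < |η|^q`. The form of `|ζ|² |η|^{2-q}` provides the terms in `ζ`,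
that of `|η|^q` the terms in `η`, and a small `δ` absorbs the mixed terms. -/
theorem lower_bound_of_lt {p q δ α₁ α₂ μ₂ μp μq K : ℝ} (hp : 2 ≤ p) (hq : q = p / (p - 1))
    (hδ : 0 ≤ δ) (hα₁ : 0 ≤ α₁) (hα₂ : 0 ≤ α₂) (hμ₂ : 0 < μ₂) (hμp : 0 ≤ μp) (hμq : 0 ≤ μq)
    (hK : 0 ≤ K)
    (hδK : δ * ((4 * K + p * q * (α₁ + α₂)) ^ 2 / μ₂ + 2 * (4 * K + p * q * (α₁ + α₂))) ≤ μq / 2)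
    {a b : Coeffs d} (haV : 0 ≤ a.V) (hbV : 0 ≤ b.V)
    (haA : ∀ ξ : CVec d, ‖mulV a.A ξ‖ ≤ K * ‖ξ‖) (hbA : ∀ ξ : CVec d, ‖mulV b.A ξ‖ ≤ K * ‖ξ‖)
    (hac : ‖a.c‖ ≤ K * √a.V) (hbb : ‖b.b‖ ≤ K * √b.V) (hbc : ‖b.c‖ ≤ K * √b.V)
    (ha2 : ∀ ξ : CVec d, μ₂ * (‖ξ‖ ^ 2 + a.V) ≤ Gam 2 a ξ)
    (ha : ∀ ξ : CVec d, μp * (‖ξ‖ ^ 2 + a.V) ≤ Gam p a ξ)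
    (hb : ∀ ξ : CVec d, μq * (‖ξ‖ ^ 2 + b.V) ≤ Gam q b ξ)
    {ζ η : ℂ} (hη : η ≠ 0) (h : ‖ζ‖ ^ p < ‖η‖ ^ q) (X Y : CVec d) :
    δ * μ₂ * (‖η‖ ^ (2 - q) * (‖X‖ ^ 2 + a.V * ‖ζ‖ ^ 2)) +
        μq / 2 * ((‖η‖ ^ (2 - q))⁻¹ * (‖Y‖ ^ 2 + b.V * ‖η‖ ^ 2)) +
        α₁ * (p * q / 4 * hessPow p ζ X + 2 * δ * hFun p ζ η X Y) +
        α₂ * (q + (2 - q) * δ) * (p / 4) * hessPow q η Y ≤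
      hessFull (bellmanQ p δ) ![a, b] ![ζ, η] ![X, Y] +
        hessPair (bellmanQ p δ) ![ζ, η] ![X, Y]
          ![((α₁ * (p * q / 4) : ℝ) : ℂ) • X, ((α₂ * (p * q / 4) : ℝ) : ℂ) • Y] := by
  obtain ⟨hq1, hq2, hpq, hpq4⟩ := conj_exponent_bounds hp hq
  obtain ⟨hB, hL⟩ := hess_bellmanQ_of_lt (d := d) (δ := δ) hp hq hη h
  have ht : 0 < ‖η‖ := norm_pos_iff.2 hη
  have hs : 0 ≤ ‖ζ‖ := norm_nonneg ζ
  have hT2 : ‖η‖ ^ (2 - q) = (‖η‖ ^ (1 - q / 2)) ^ 2 := by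
    rw [← Real.rpow_natCast, ← Real.rpow_mul ht.le]; congr 1; push_cast; ring
  have hT : 0 < ‖η‖ ^ (1 - q / 2) := by positivity
  have hTinv : ‖η‖ ^ (q - 2) = (‖η‖ ^ (2 - q))⁻¹ := by
    rw [← Real.rpow_neg ht.le]; congr 1; ring
  have hρ0 : 0 ≤ ‖ζ‖ * ‖η‖ ^ (1 - q) := by positivity
  have hρ1 : ‖ζ‖ * ‖η‖ ^ (1 - q) ≤ 1 := by
    refine (mul_le_mul_of_nonneg_right (le_of_rpow_lt hp hq hs ht.le h) (by positivity)).trans_eq ?_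
    rw [← Real.rpow_add ht]; simp
  have hbfun : hFun p ζ η X Y = ‖η‖ ^ (2 - q) * ‖X‖ ^ 2 +
      (1 - q / 2) ^ 2 * ((‖ζ‖ * ‖η‖ ^ (1 - q)) ^ 2 / ‖η‖ ^ (2 - q)) * ‖reV (rot η Y)‖ ^ 2 +
      2 * (1 - q / 2) * (‖ζ‖ * ‖η‖ ^ (1 - q)) * inner ℝ (reV (rot ζ X)) (reV (rot η Y)) := by
    rw [hFun, ← hq, if_pos h, bFun, ← hq]
    have e : (‖ζ‖ * ‖η‖ ^ (1 - q)) ^ 2 / ‖η‖ ^ (2 - q) = ‖ζ‖ ^ 2 * ‖η‖ ^ (-q) := by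
      rw [div_eq_iff (by positivity), mul_assoc, ← Real.rpow_add ht, mul_pow,
        ← Real.rpow_natCast (‖η‖ ^ (1 - q)), ← Real.rpow_mul ht.le]
      congr 2; push_cast; ring
    rw [e]; ring
  obtain ⟨m, hm⟩ : ∃ m, m = mixBil q (‖η‖ ^ (2 - q)) (‖ζ‖ * ‖η‖ ^ (1 - q)) ζ η X Y
        (mulV a.A X) (mulV b.A Y) +
      mixBil q (‖η‖ ^ (2 - q)) (‖ζ‖ * ‖η‖ ^ (1 - q)) ζ η X Y (ζ • a.c) (η • b.c) +
      mixLin q (‖η‖ ^ (2 - q)) (‖ζ‖ * ‖η‖ ^ (1 - q)) ζ η (cdot X (conjV a.b))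
        (cdot Y (conjV b.b)) +
      mixLin q (‖η‖ ^ (2 - q)) (‖ζ‖ * ‖η‖ ^ (1 - q)) ζ η (a.V * ζ) (b.V * η) := ⟨_, rfl⟩
  have hfull : hessFull (bellmanQ p δ) ![a, b] ![ζ, η] ![X, Y] =
      p * ‖ζ‖ ^ (p - 2) * quad p a ‖ζ‖ (rot ζ X) +
        q * (‖η‖ ^ (2 - q))⁻¹ * quad q b ‖η‖ (rot η Y) + δ * m := by
    rw [hessFull_pair, hB, hB, hL, hL, hm, ← hTinv, ← powBil_add_powLin, ← powBil_add_powLin]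
    ring
  rw [mixBil_add_mixLin, hT2] at hm
  have hpq_quad : 0 ≤ p * ‖ζ‖ ^ (p - 2) * quad p a ‖ζ‖ (rot ζ X) :=
    mul_nonneg (by positivity) ((by positivity : (0 : ℝ) ≤ _).trans (le_quad ha hs (rot ζ X)))
  have hqa := le_quad ha2 hs (rot ζ X)
  have hqb := le_quad hb ht.le (rot η Y)
  have hmix := mixed_terms_lower_bound hq1 hq2 hT hρ0 hρ1 hK hs ht.le hbV haA hbA hac hbb hbc
    (rot ζ X) (rot η Y)
  have hsc := scalar_perturbation_lower_bound hq1 hq2 hpq4 hT hρ0 hρ1 hα₁ hα₂ ζ η X Y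
  rw [norm_rot] at hqa hqb
  rw [norm_rot, norm_rot] at hmix
  replace hmix := add_le_add_right hmix
    (2 * (‖η‖ ^ (1 - q / 2)) ^ 2 * quad 2 a ‖ζ‖ (rot ζ X))
  rw [← hm] at hmix
  rw [hfull, hB, powBil_real_smul _ _ (Or.inr hp), powBil_real_smul _ _ (Or.inl hη), hbfun, hT2]
  rw [hessPow_eq (Or.inl hη) Y, hTinv, hT2]
  set T := ‖η‖ ^ (1 - q / 2)
  have hx : T ^ 2 * (‖X‖ ^ 2 + a.V * ‖ζ‖ ^ 2) = (T * ‖X‖) ^ 2 + (T * (‖ζ‖ * √a.V)) ^ 2 := by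
    rw [mul_pow, mul_pow, mul_pow, Real.sq_sqrt haV]; ring
  have hy : (T ^ 2)⁻¹ * (‖Y‖ ^ 2 + b.V * ‖η‖ ^ 2) = (‖Y‖ / T) ^ 2 + (‖η‖ * √b.V / T) ^ 2 := by
    rw [div_pow, div_pow, mul_pow, Real.sq_sqrt hbV]; field_simp
  have hab := absorb (x := T * ‖X‖) (v := T * (‖ζ‖ * √a.V)) (y := ‖Y‖ / T)
    (w := ‖η‖ * √b.V / T) hμ₂ hδ (by positivity : 0 ≤ 4 * K + p * q * (α₁ + α₂)) hδK
  rw [← hx, ← hy] at hab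
  have k1 : μq * ((T ^ 2)⁻¹ * (‖Y‖ ^ 2 + b.V * ‖η‖ ^ 2)) ≤
      q * (T ^ 2)⁻¹ * quad q b ‖η‖ (rot η Y) := by
    have h0 : 0 ≤ μq * (‖Y‖ ^ 2 + b.V * ‖η‖ ^ 2) := by positivity
    have h1 := mul_le_mul hq1.le hqb h0 (by linarith)
    have h2 := mul_le_mul_of_nonneg_left h1 (by positivity : 0 ≤ (T ^ 2)⁻¹)
    linarith
  have k2 := mul_le_mul_of_nonneg_left hqa (by positivity : 0 ≤ δ * (2 * T ^ 2))
  have k3 := mul_le_mul_of_nonneg_left hmix hδ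
  have k4 := mul_le_mul_of_nonneg_left hsc hδ
  have k5 : 0 ≤ δ * (p * q * (α₁ + α₂)) * ((T * ‖X‖) * (‖η‖ * √b.V / T) +
      (T * (‖ζ‖ * √a.V)) * (‖Y‖ / T) + (‖Y‖ / T) * (‖η‖ * √b.V / T)) := by positivity
  linarith

/-- Passage from the reduced potential `(1 - σ) V` back to `V`. -/
theorem weight_le {C c σ τ n V s : ℝ} (hC : C ≤ c * (1 - σ)) (hc : 0 ≤ c) (hσ : 0 ≤ σ)
    (hτ : 0 ≤ τ) (hn : 0 ≤ n) (hV : 0 ≤ V) (hs : 0 ≤ s) :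
    C * (τ * (n + V * s)) ≤ c * (τ * (n + (1 - σ) * V * s)) := by
  have h1 : C ≤ c := hC.trans (mul_le_of_le_one_right hc (by linarith))
  have h2 := mul_le_mul_of_nonneg_right h1 (by positivity : 0 ≤ τ * n)
  have h3 := mul_le_mul_of_nonneg_right hC (by positivity : 0 ≤ τ * (V * s))
  linarith

end LowerBounds

end BellmanConvexity

theorem theorem6p4
    -- the exponents and the perturbation parameters
    (p q : ℝ) (hp : 2 ≤ p) (hq : q = p / (p - 1))
    (α₁ α₂ σ₁ σ₂ : ℝ) (hα₁ : 0 ≤ α₁) (hα₂ : 0 ≤ α₂)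
    (hσ₁ : σ₁ ∈ Set.Ico (0 : ℝ) 1) (hσ₂ : σ₂ ∈ Set.Ico (0 : ℝ) 1)
    -- the ellipticity constants of the two perturbed tuples
    (lam₁ Lam₁ M₁ μ₁ μp lam₂ Lam₂ M₂ μq : ℝ)
    (hlam₁ : 0 < lam₁) (hLam₁ : 0 < Lam₁) (hM₁ : 0 < M₁) (hμ₁ : 0 < μ₁) (hμp : 0 < μp)
    (hlam₂ : 0 < lam₂) (hLam₂ : 0 < Lam₂) (hM₂ : 0 < M₂) (hμq : 0 < μq) :
    (Continuous (tau p) ∧ (∀ ω, 0 ≤ tau p ω) ∧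
      LocallyIntegrableOn (fun ω => (tau p ω)⁻¹) ({(0, 0)}ᶜ : Set (ℂ × ℂ)) volume) ∧
    ∃ δ ∈ Set.Ioo (0 : ℝ) 1, ∃ Ct : ℝ, 0 < Ct ∧
      ∀ (d : ℕ) (Ω : Set (RVec d)) (𝒜 ℬ : CoeffField d), IsOpen Ω →
        PElliptic Ω p (fun x => (𝒜 x).A) → PElliptic Ω p (fun x => (ℬ x).A) →
        MemLp (fun x => (𝒜 x).b) ∞ (volume.restrict Ω) →
        MemLp (fun x => (𝒜 x).c) ∞ (volume.restrict Ω) →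
        MemLp (fun x => (ℬ x).b) ∞ (volume.restrict Ω) →
        MemLp (fun x => (ℬ x).c) ∞ (volume.restrict Ω) →
        LocallyIntegrableOn (fun x => (𝒜 x).V) Ω volume →
        LocallyIntegrableOn (fun x => (ℬ x).V) Ω volume →
        ClassS Ω p (pert p α₁ σ₁ 𝒜) → ClassS Ω 2 (pert p α₁ σ₁ 𝒜) →
        ClassS Ω q (pert p α₂ σ₂ ℬ) →
        -- the constants fixed above are admissible
        EllipticWith Ω (fun x => (pert p α₁ σ₁ 𝒜 x).A) lam₁ Lam₁ →
        FirstOrderBound Ω (pert p α₁ σ₁ 𝒜) M₁ →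
        GamBound Ω 2 (pert p α₁ σ₁ 𝒜) μ₁ → GamBound Ω p (pert p α₁ σ₁ 𝒜) μp →
        EllipticWith Ω (fun x => (pert p α₂ σ₂ ℬ x).A) lam₂ Lam₂ →
        FirstOrderBound Ω (pert p α₂ σ₂ ℬ) M₂ →
        GamBound Ω q (pert p α₂ σ₂ ℬ) μq →
        ∀ᵐ x ∂(volume.restrict Ω), ∀ ζ η : ℂ, (ζ, η) ∉ excSet p → ∀ X Y : CVec d,
          Ct * (tau p (ζ, η) * (‖X‖ ^ 2 + max (𝒜 x).V 0 * ‖ζ‖ ^ 2) +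
              (tau p (ζ, η))⁻¹ * (‖Y‖ ^ 2 + max (ℬ x).V 0 * ‖η‖ ^ 2)) +
            α₁ * (p * q / 4 * hessPow p ζ X + 2 * δ * hFun p ζ η X Y) +
            α₂ * (q + (2 - q) * δ) * (p / 4) * hessPow q η Y +
            gradV (bellmanQ p δ) ![σ₁ * max (𝒜 x).V 0, σ₂ * max (ℬ x).V 0] ![ζ, η] ≤
          hessFull (bellmanQ p δ) ![plusPart 𝒜 x, plusPart ℬ x] ![ζ, η] ![X, Y] := by
  refine ⟨⟨continuous_tau hp, tau_nonneg p, locallyIntegrableOn_tau_inv hp⟩, ?_⟩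
  obtain ⟨hq1, hq2, hpq, hpq4⟩ := conj_exponent_bounds hp hq
  have hc₁ : 0 ≤ coeffConst 2 Lam₁ M₁ := by unfold coeffConst; positivity
  have hc₂ : 0 ≤ coeffConst q Lam₂ M₂ := by unfold coeffConst; positivity
  -- One constant bounding the matrices and, relative to `√V` and `√W`, the first-order terms.
  set K := Lam₁ + Lam₂ + coeffConst 2 Lam₁ M₁ + coeffConst q Lam₂ M₂ with hK
  have hK0 : 0 ≤ K := by positivity
  set L := (4 * K + p * q * (α₁ + α₂)) ^ 2 / μ₁ + 2 * (4 * K + p * q * (α₁ + α₂)) with hL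
  have hL0 : 0 ≤ L := by positivity
  -- The denominator is chosen so that `δ L ≤ μq / 2`, as `absorb` requires; the bound `1 / 2`
  -- keeps `δ < 1`.
  set δ := min (1 / 2) (μq / (2 * (L + 1))) with hδ
  have hδ0 : 0 < δ := lt_min (by norm_num) (by positivity)
  have hδ1 : δ < 1 := (min_le_left _ _).trans_lt (by norm_num)
  have hδL : δ * L ≤ μq / 2 := by
    have h1 : δ ≤ μq / (2 * (L + 1)) := min_le_right _ _
    rw [le_div_iff₀ (by positivity)] at h1
    linarith
  have hσ₁' : 0 < 1 - σ₁ := by linarith [hσ₁.2]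
  have hσ₂' : 0 < 1 - σ₂ := by linarith [hσ₂.2]
  set Ct := min (min (δ * μ₁ * (1 - σ₁)) (μp * (1 - σ₁))) (μq / 2 * (1 - σ₂)) with hCt
  have hCt1 : Ct ≤ δ * μ₁ * (1 - σ₁) := (min_le_left _ _).trans (min_le_left _ _)
  have hCt2 : Ct ≤ μp * (1 - σ₁) := (min_le_left _ _).trans (min_le_right _ _)
  have hCt3 : Ct ≤ μq / 2 * (1 - σ₂) := min_le_right _ _
  refine ⟨δ, ⟨hδ0, hδ1⟩, Ct, lt_min (lt_min (by positivity) (by positivity)) (by positivity), ?_⟩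
  intro d Ω 𝒜 ℬ _ _ _ _ _ _ _ _ _ _ _ _ hA hMA hG2 hGp hB hMB hGq
  filter_upwards [hA.2, hMA, hG2, hGp, hB.2, hMB, hGq] with x hA hMA hG2 hGp hB hMB hGq
  intro ζ η hexc X Y
  obtain ⟨hη, hne⟩ : η ≠ 0 ∧ ‖ζ‖ ^ p ≠ ‖η‖ ^ q := by
    simpa [excSet, not_or, ← hq] using hexc
  have hV : 0 ≤ max (𝒜 x).V 0 := le_max_right _ _
  have hW : 0 ≤ max (ℬ x).V 0 := le_max_right _ _
  have haV : 0 ≤ (pert p α₁ σ₁ 𝒜 x).V := mul_nonneg hσ₁'.le hV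
  have hbV : 0 ≤ (pert p α₂ σ₂ ℬ x).V := mul_nonneg hσ₂'.le hW
  rw [hessFull_eq_perturbed (bellmanQ p δ) (plusPart 𝒜 x) (plusPart ℬ x) (pert p α₁ σ₁ 𝒜 x)
    (pert p α₂ σ₂ ℬ x) (α₁ * (p * q / 4)) (α₂ * (p * q / 4)) (σ₁ * max (𝒜 x).V 0)
    (σ₂ * max (ℬ x).V 0) ζ η X Y (by rw [hq]; rfl) rfl rfl (by simp only [plusPart, pert]; ring)
    (by rw [hq]; rfl) rfl rfl (by simp only [plusPart, pert]; ring)]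
  -- The terms with `σ₁ V_+` and `σ₂ W_+` agree on both sides.
  refine add_le_add_left ?_ _
  rcases lt_or_gt_of_ne hne with h | h
  · obtain ⟨-, hac⟩ := norm_coeff_le (by norm_num) hLam₁ hM₁.le hA.2 haV
      (fun ξ => le_trans (by positivity) (hG2 ξ)) hMA
    obtain ⟨hbb, hbc⟩ := norm_coeff_le hq1.le hLam₂ hM₂.le hB.2 hbV
      (fun ξ => le_trans (by positivity) (hGq ξ)) hMB
    have hmono : ∀ {c y z : ℝ}, c ≤ K → 0 ≤ z → y ≤ c * z → y ≤ K * z :=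
      fun hc hz hy => hy.trans (mul_le_mul_of_nonneg_right hc hz)
    have key := lower_bound_of_lt hp hq hδ0.le hα₁ hα₂ hμ₁ hμp.le hμq.le hK0 hδL haV hbV
      (fun ξ => hmono (by linarith) (norm_nonneg _) (norm_mulV_le hLam₁.le hA.2 ξ))
      (fun ξ => hmono (by linarith) (norm_nonneg _) (norm_mulV_le hLam₂.le hB.2 ξ))
      (hmono (by linarith) (Real.sqrt_nonneg _) hac)
      (hmono (by linarith) (Real.sqrt_nonneg _) hbb)
      (hmono (by linarith) (Real.sqrt_nonneg _) hbc) hG2 hGp hGq hη h X Y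
    rw [tau_of_lt hp hq h, mul_add Ct]
    have w1 := weight_le hCt1 (by positivity) hσ₁.1 (by positivity : 0 ≤ ‖η‖ ^ (2 - q))
      (sq_nonneg ‖X‖) hV (sq_nonneg ‖ζ‖)
    have w2 := weight_le hCt3 (by positivity) hσ₂.1 (by positivity : 0 ≤ (‖η‖ ^ (2 - q))⁻¹)
      (sq_nonneg ‖Y‖) hW (sq_nonneg ‖η‖)
    simp only [pert] at key ⊢
    linarith
  · have key := lower_bound_of_gt (α₂ := α₂) hp hq hδ0.le hα₁ hμp.le hμq.le haV hbV hGp hGq hη h X Y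
    obtain ⟨hτ, hτ'⟩ := tau_of_gt hp hq h
    rw [hτ, mul_add Ct]
    have ht : 0 < ‖η‖ := norm_pos_iff.2 hη
    have hinv : (‖ζ‖ ^ (p - 2))⁻¹ ≤ ‖η‖ ^ (q - 2) := by
      rw [show q - 2 = -(2 - q) by ring, Real.rpow_neg ht.le]
      exact inv_anti₀ (by positivity) hτ'
    have w1 := weight_le hCt2 hμp.le hσ₁.1 (by positivity : 0 ≤ ‖ζ‖ ^ (p - 2))
      (sq_nonneg ‖X‖) hV (sq_nonneg ‖ζ‖)
    have w2 := weight_le (c := μq) (hCt3.trans (mul_le_mul_of_nonneg_right (by linarith) hσ₂'.le))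
      hμq.le hσ₂.1 (by positivity : 0 ≤ (‖ζ‖ ^ (p - 2))⁻¹)
      (sq_nonneg ‖Y‖) hW (sq_nonneg ‖η‖)
    have w3 := mul_le_mul_of_nonneg_left (mul_le_mul_of_nonneg_right hinv
      (by positivity : 0 ≤ ‖Y‖ ^ 2 + (1 - σ₂) * max (ℬ x).V 0 * ‖η‖ ^ 2)) hμq.le
    simp only [pert] at key ⊢
    linarith
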